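/- **Setting.** Let $\mathbf X=(\mathbf X_1,\dots,\mathbf X_K)$ be random variables with values in a measurable space $\mathcal X$, where the block $\mathbf X_k=(\mathbf x_{k1},\dots,\mathbf x_{km_k})$ has a dependency graph $G_k$ on $[m_k]=\{1,\dots,m_k\}$, that is, for every independent set $I$ of vertices of $G_k$ the variables $(\mathbf x_{ki})_{i\in I}$ are mutually independent (nothing is assumed about the dependence between blocks), and $m=\sum_k m_k\ge 1$. A *fractional independent vertex cover* of a graph $G=(V,E)$ is a finite family $(I_j,\omega_j)_{j\in[J]}$ of independent sets $I_j\subseteq V$ and weights $\omega_j\in(0,1]$ with $\sum_{j:\,u\in I_j}\omega_j=1$ for all $u\in V$; the *fractional chromatic number* $\chi_f(G)$ is the minimum of $\sum_j\omega_j$ over all such covers. Let $f:\mathcal X^m\to\mathbb R$ be *multi-fractionally sub-additive*: $f(\mathbf X)=\sum_{k\in[K]} f_k(\mathbf X_k)$ with $f_k(\mathbf X_k)=\sum_{j\in[J_k]}\omega_{kj}f_{kj}(\mathbf x_{I_{kj}})$, where $(I_{kj},\omega_{kj})_{j\in[J_k]}$ is a fractional independent vertex cover of $G_k$ of total weight $\sum_j\omega_{kj}=\chi_f(G_k)$,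 and each measurable function $f_{kj}$ is sub-additive, i.e. there are measurable functions $f_{kj}^{\backslash i}$, $i\in I_{kj}$, of the tuples with the $i$-th entry removed such that $\sum_{i\in I_{kj}}\bigl(f_{kj}(x)-f_{kj}^{\backslash i}(x^{\backslash i})\bigr)\le f_{kj}(x)$ for all $x$. Put $Z=f(\mathbf X)$, $Z_{kj}=f_{kj}(\mathbf x_{I_{kj}})$ and $Z_{kj}^{\backslash i}=f_{kj}^{\backslash i}(\mathbf x_{I_{kj}\setminus\{i\}})$, and let $\mathbb E_{kji}$ be the conditional expectation given $\mathbf x_{I_{kj}\setminus\{i\}}$. Assume that every $Z_{kj}$ is integrable and that there are a constant $b\in\mathbb R$, constants $\sigma_{kj}^2\in\mathbb R$ and square-integrable $\sigma(\mathbf x_{I_{kj}})$-measurable random variables $Y_{kji}$ such that for all $k\in[K]$, $j\in[J_k]$, $i\in I_{kj}$, almost surely, $$Y_{kji}\le Z_{kj}-Z_{kj}^{\backslash i}\le 1,\qquad \mathbb E_{kji}[Y_{kji}]\ge 0,\qquad Y_{kji}\le b,\qquad \sum_{i\in I_{kj}}\mathbb E_{kji}[Y_{kji}^2]\le\sigma_{kj}^2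 .$$ Let $\varphi(x)=(1+x)\log(1+x)-x$, $\sigma^2=\sum_{k}\sum_{j}\omega_{kj}\sigma_{kj}^2$, $v=(1+b)\,\mathbb E[Z]+\sigma^2$ and $c=\sum_{k\in[K]}\chi_f(G_k)$. **Theorem (special Bennett inequality).** Suppose that all weights are $\omega_{kj}=1$. Then: 1. for every $t>0$ (and $v>0$), $\displaystyle \mathbb P\bigl(Z\ge\mathbb E[Z]+t\bigr)\le\exp\Bigl(-v\,\varphi\Bigl(\frac{t}{v\sum_{k\in[K]}\chi_f(G_k)}\Bigr)\Bigr)$; 2. for every $t>0$, $\displaystyle \mathbb P\Bigl(Z\ge\mathbb E[Z]+c\sqrt{2vt}+\frac{2ct}{3}\Bigr)\le e^{-t}$, i.e. with probability at least $1-e^{-t}$, $Z<\mathbb E[Z]+c\sqrt{2vt}+\frac{2ct}{3}$. In particular, for $K=1$ and $\chi_f(G_1)=1$ (which holds when $G_1$ has no edges, e.g. for i.i.d. variables), for every $t>0$ one has $\mathbb P(Z\ge\mathbb E[Z]+t)\le\exp(-v\varphi(t/v))$ (if $v>0$) and $\mathbb P\bigl(Z\ge\mathbb E[Z]+\sqrt{2vt}+\frac{2t}{3}\bigr)\le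 e^{-t}$. -/

import Mathlib

open MeasureTheory ProbabilityTheory

/-- `{(I_j, ω_j)}_{j ∈ [J]}` is a fractional independent vertex cover of `G`: the weights lie in
`(0, 1]`, the total weight at each vertex is `1`, and every `I_j` is an independent set. -/
structure IsFracIndepCover {V : Type*} [DecidableEq V] (G : SimpleGraph V) {J : ℕ}
    (I : Fin J → Finset V) (ω : Fin J → ℝ) : Prop where
  weight_pos : ∀ j, 0 < ω j
  weight_le_one : ∀ j, ω j ≤ 1
  sum_weight : ∀ v : V, ∑ j with v ∈ I j, ω j = 1
  indep : ∀ j, G.IsIndepSet (I j : Set V)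

/-- The fractional chromatic number `χ_f(G)`: the least total weight of a fractional independent
vertex cover of `G`. -/
noncomputable def fracChromaticNumber {V : Type*} [DecidableEq V] (G : SimpleGraph V) : ℝ :=
  sInf {s : ℝ | ∃ (J : ℕ) (I : Fin J → Finset V) (ω : Fin J → ℝ),
    IsFracIndepCover G I ω ∧ s = ∑ j, ω j}

/-- `G` is a dependency graph of the family `X`: on every set of pairwise non-adjacent vertices the
variables are (mutually) independent. Every dependency graph in the sense that non-adjacent
disjoint vertex sets carry independent families has this property. -/
def IsDependencyGraph {Ω 𝒳 V : Type*} [MeasurableSpace Ω] [MeasurableSpace 𝒳]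
    (G : SimpleGraph V) (X : V → Ω → 𝒳) (P : Measure Ω) : Prop :=
  ∀ S : Finset V, G.IsIndepSet (S : Set V) → iIndepFun (fun i : S => X i) P

/-- The tuple `x` with its `i`-th entry removed. -/
def deleteAt {ι 𝒳 : Type*} (i : ι) (x : ι → 𝒳) : {i' : ι // i' ≠ i} → 𝒳 := fun i' => x i'

/-- `f` is sub-additive, witnessed by the functions `g i` of the tuples with `i`-th entry removed:
`∑ i, (f x - g i (x without x_i)) ≤ f x` for all `x`. -/
def IsSubAdditiveWith {ι 𝒳 : Type*} [Fintype ι] (f : (ι → 𝒳) → ℝ)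
    (g : ∀ i : ι, ({i' : ι // i' ≠ i} → 𝒳) → ℝ) : Prop :=
  ∀ x : ι → 𝒳, ∑ i, (f x - g i (deleteAt i x)) ≤ f x

/-- A decomposition that makes `f` multi-fractionally sub-additive with respect to the graphs
`G 1, …, G K`: `f x = ∑ k, f_k x_k`, where each `f_k` is fractionally colorable with respect to
`G k`, `f_k = ∑ j, ω_kj f_kj (x_{I_kj})`, and every `f_kj` is sub-additive. -/
structure MultiFracDecomp {𝒳 : Type*} [MeasurableSpace 𝒳] {K : ℕ} {m : Fin K → ℕ}
    (G : ∀ k, SimpleGraph (Fin (m k))) (f : (∀ k, Fin (m k) → 𝒳) → ℝ) where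
  /-- The number of parts for each block. -/
  J : Fin K → ℕ
  /-- The vertex sets `I_kj`. -/
  I : ∀ k, Fin (J k) → Finset (Fin (m k))
  /-- The weights `ω_kj`. -/
  ω : ∀ k, Fin (J k) → ℝ
  /-- The block functions `f_k`. -/
  fBlock : ∀ k, (Fin (m k) → 𝒳) → ℝ
  /-- The functions `f_kj`. -/
  fPart : ∀ k (j : Fin (J k)), (I k j → 𝒳) → ℝ
  /-- The functions that witness the sub-additivity of `f_kj`. -/
  fDel : ∀ k (j : Fin (J k)) (i : I k j), ({i' : I k j // i' ≠ i} → 𝒳) → ℝ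
  cover : ∀ k, IsFracIndepCover (G k) (I k) (ω k)
  eq_sum_block : ∀ x, f x = ∑ k, fBlock k (x k)
  block_eq_sum : ∀ k (x : Fin (m k) → 𝒳),
    fBlock k x = ∑ j, ω k j * fPart k j (fun i => x i)
  subAdditive : ∀ k j, IsSubAdditiveWith (fPart k j) (fDel k j)
  measurable_fPart : ∀ k j, Measurable (fPart k j)
  measurable_fDel : ∀ k j i, Measurable (fDel k j i)

namespace MultiFracDecomp

variable {Ω 𝒳 : Type*} [MeasurableSpace 𝒳] {K : ℕ} {m : Fin K → ℕ}
  {G : ∀ k, SimpleGraph (Fin (m k))} {f : (∀ k, Fin (m k) → 𝒳) → ℝ}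

/-- The random tuple `x_{I_kj}`. -/
def xPart (D : MultiFracDecomp G f) (X : ∀ k, Fin (m k) → Ω → 𝒳) (k : Fin K) (j : Fin (D.J k))
    (w : Ω) : D.I k j → 𝒳 := fun i => X k i w

/-- The random variable `Z_kj = f_kj (x_{I_kj})`. -/
def zPart (D : MultiFracDecomp G f) (X : ∀ k, Fin (m k) → Ω → 𝒳) (k : Fin K) (j : Fin (D.J k))
    (w : Ω) : ℝ := D.fPart k j (D.xPart X k j w)

/-- The random variable `Z_kj^{∖ i}`, a function of `x_{I_kj}` without `x_i`. -/
def zDel (D : MultiFracDecomp G f) (X : ∀ k, Fin (m k) → Ω → 𝒳) (k : Fin K) (j : Fin (D.J k))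
    (i : D.I k j) (w : Ω) : ℝ := D.fDel k j i (deleteAt i (D.xPart X k j w))

/-- The `σ`-algebra generated by `x_{I_kj}`. -/
abbrev sigmaPart (D : MultiFracDecomp G f) (X : ∀ k, Fin (m k) → Ω → 𝒳) (k : Fin K)
    (j : Fin (D.J k)) : MeasurableSpace Ω :=
  MeasurableSpace.comap (D.xPart X k j) inferInstance

/-- The `σ`-algebra generated by `x_{I_kj}` without `x_i`. -/
abbrev sigmaDel (D : MultiFracDecomp G f) (X : ∀ k, Fin (m k) → Ω → 𝒳) (k : Fin K)
    (j : Fin (D.J k)) (i : D.I k j) : MeasurableSpace Ω :=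
  MeasurableSpace.comap (fun w => deleteAt i (D.xPart X k j w)) inferInstance

/-- The assumption on the parts of `f`, with the variables `Y_kji` and the constants `b_kj` and
`σ_kj²` (here `σsq k j`). Integrability of `Z_kj` and square integrability of `Y_kji` are what the
expectation of `Z_kj` and the conditional expectations presuppose. -/
structure BennettAssumption [MeasurableSpace Ω] (D : MultiFracDecomp G f)
    (X : ∀ k, Fin (m k) → Ω → 𝒳) (P : Measure Ω) (Y : ∀ k (j : Fin (D.J k)), D.I k j → Ω → ℝ)
    (b σsq : ∀ k, Fin (D.J k) → ℝ) : Prop where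
  integrable_zPart : ∀ k j, Integrable (D.zPart X k j) P
  measurable_Y : ∀ k j i, Measurable[D.sigmaPart X k j] (Y k j i)
  memLp_Y : ∀ k j i, MemLp (Y k j i) 2 P
  Y_le_sub : ∀ k j i, ∀ᵐ w ∂P, Y k j i w ≤ D.zPart X k j w - D.zDel X k j i w
  sub_le_one : ∀ k j i, ∀ᵐ w ∂P, D.zPart X k j w - D.zDel X k j i w ≤ 1
  condExp_Y_nonneg : ∀ k j i, ∀ᵐ w ∂P, 0 ≤ (P[Y k j i | D.sigmaDel X k j i]) w
  Y_le : ∀ k j i, ∀ᵐ w ∂P, Y k j i w ≤ b k j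
  sum_condExp_sq_le : ∀ k j, ∀ᵐ w ∂P,
    ∑ i, (P[fun w' => Y k j i w' ^ 2 | D.sigmaDel X k j i]) w ≤ σsq k j

end MultiFracDecomp

/-- `φ(x) = (1 + x) log (1 + x) - x`. -/
noncomputable def bennettPhi (x : ℝ) : ℝ := (1 + x) * Real.log (1 + x) - x

/-! Each part `Z_kj` depends only on variables indexed by an independent set of `G_k`, hence on
mutually independent variables, so Bousquet's inequality for sub-additive functions
(`BousquetHyp.mgf_le`) bounds its moment generating function by `exp(l E + v_kj (e^l - l - 1))`,
with `E` the mean of `Z_kj` and `v_kj = (1 + b) E + σ_kj²`.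

That inequality comes from the entropy method. The modified logarithmic Sobolev inequality
(`entropy_exp_le`) bounds the entropy of `e^{lZ}` by one term per variable. The elementary
inequality `entTerm_le`, with `x = Z - Z^{∖ i}` and `y = Y_i`, turns these terms into quantities
that sub-additivity, `E_i[Y_i] ≥ 0` and the variance bound control (`entropy_le`). What results is a
linear differential inequality for the log-moment generating function, which integrates exactly
(`le_of_entropy_differential_inequality`).

The parts may depend on each other arbitrarily, so they are combined by convexity of `exp` alone
(`mgf_sum_le`). With all weights `1` the number `N` of parts equals `c`, and averaging with weights
`1/N` replaces `l` by `l/N`. Markov's inequality then gives the Bennett bound, and `φ(x) ≥ x²/(2 +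
2x/3)` turns it into the bound with the square root. -/

/-! ### Real inequalities -/

/-- A function that vanishes at `1` and to second order at `0`, and whose second derivative changes
sign at most once, from `+` to `-` and not before `0`, is nonnegative on `(-∞, 1]`. -/
lemma nonneg_of_deriv2_sign {R R₁ R₂ : ℝ → ℝ} (h₁ : ∀ x, HasDerivAt R (R₁ x) x)
    (h₂ : ∀ x, HasDerivAt R₁ (R₂ x) x) (hsign : ∀ x y, x ≤ y → 0 ≤ R₂ y → 0 ≤ R₂ x)
    (h0 : 0 ≤ R₂ 0) (hR0 : R 0 = 0) (hR₁0 : R₁ 0 = 0) (hR1 : R 1 = 0) {x : ℝ} (hx : x ≤ 1) :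
    0 ≤ R x := by
  have mvt : ∀ {F F' : ℝ → ℝ}, (∀ x, HasDerivAt F (F' x) x) → ∀ {a b : ℝ}, a < b →
      ∃ c ∈ Set.Ioo a b, F' c = (F b - F a) / (b - a) := fun {F F'} hF a b hab =>
    exists_hasDerivAt_eq_slope F F' hab (fun y _ => (hF y).continuousAt.continuousWithinAt)
      (fun y _ => hF y)
  by_contra! hneg
  have hx0 : x ≠ 0 := by rintro rfl; linarith
  have hx1 : x ≠ 1 := by rintro rfl; linarith
  -- A negative value at `x < 0` forces `R₂ < 0` somewhere left of `0`, where `R₂ ≥ 0`. A negative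
  -- value inside `(0, 1)` forces `R₂ < 0` at some `η` and, since `R` climbs back to `0` at `1`, `R₂
  -- > 0` at a later `κ`.
  rcases lt_or_gt_of_ne hx0 with hlt | hgt
  · obtain ⟨ξ, hξ, hξ'⟩ := mvt h₁ hlt
    obtain ⟨η, hη, hη'⟩ := mvt h₂ hξ.2
    have h3 : 0 < R₁ ξ := by rw [hξ', hR0]; exact div_pos (by linarith) (by linarith)
    have h4 : R₂ η < 0 := by
      rw [hη', hR₁0]; exact div_neg_of_neg_of_pos (by linarith) (by linarith [hξ.2])
    linarith [hsign η 0 hη.2.le h0]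
  · have hlt1 : x < 1 := lt_of_le_of_ne hx hx1
    obtain ⟨ξ, hξ, hξ'⟩ := mvt h₁ hgt
    obtain ⟨η, hη, hη'⟩ := mvt h₂ hξ.1
    obtain ⟨ζ, hζ, hζ'⟩ := mvt h₁ hlt1
    obtain ⟨κ, hκ, hκ'⟩ := mvt h₂ (hξ.2.trans hζ.1)
    have h3 : R₁ ξ < 0 := by
      rw [hξ', hR0]; exact div_neg_of_neg_of_pos (by linarith) (by linarith)
    have h4 : R₂ η < 0 := by
      rw [hη', hR₁0]; exact div_neg_of_neg_of_pos (by linarith) (by linarith [hξ.1])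
    have h5 : 0 < R₁ ζ := by rw [hζ', hR1]; exact div_pos (by linarith) (by linarith)
    have h6 : 0 < R₂ κ := by
      rw [hκ']; exact div_pos (by linarith) (by linarith [hξ.2, hζ.1])
    linarith [hsign η κ (hη.2.le.trans hκ.1.le) h6.le]

/-- The difference has derivative `l (1 - e^{-l}) ≥ 0`. It supplies the second-derivative condition
at `0` in `entTerm_le_quadratic`. -/
lemma one_add_mul_exp_neg_ge {l : ℝ} (hl : 0 ≤ l) :
    1 - l ^ 2 / 2 ≤ (1 + l) * Real.exp (-l) := by
  have hder : ∀ x : ℝ, HasDerivAt (fun x => (1 + x) * Real.exp (-x) + x ^ 2 / 2)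
      (x * (1 - Real.exp (-x))) x := fun x => by
    have := (((hasDerivAt_id x).const_add 1).mul ((hasDerivAt_id x).neg.exp)).add
      (((hasDerivAt_id x).pow 2).div_const 2)
    refine this.congr_deriv ?_
    simp; ring
  have hmono : MonotoneOn (fun x : ℝ => (1 + x) * Real.exp (-x) + x ^ 2 / 2) (Set.Ici 0) := by
    refine monotoneOn_of_hasDerivWithinAt_nonneg (convex_Ici 0)
      (fun x _ => (hder x).continuousAt.continuousWithinAt)
      (fun x _ => (hder x).hasDerivWithinAt) (fun x hx => ?_)
    rw [interior_Ici] at hx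
    have : Real.exp (-x) ≤ 1 := Real.exp_le_one_iff.2 (by linarith [Set.mem_Ioi.1 hx])
    exact mul_nonneg (Set.mem_Ioi.1 hx).le (by linarith)
  have := hmono (Set.mem_Ici.2 le_rfl) (Set.mem_Ici.2 hl) hl
  simp at this
  linarith

/-- Up to a factor `l`, this is the second-derivative condition at `0` in `entTerm_le_linear`. -/
lemma two_add_le_mul_exp {l : ℝ} (hl : 0 ≤ l) :
    0 ≤ 2 + l - 2 * Real.exp l + l * Real.exp l := by
  have hder : ∀ x : ℝ, HasDerivAt (fun x => 2 + x - 2 * Real.exp x + x * Real.exp x)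
      (1 - Real.exp x + x * Real.exp x) x := fun x => by
    have := (((hasDerivAt_id x).const_add 2).sub ((Real.hasDerivAt_exp x).const_mul 2)).add
      ((hasDerivAt_id x).mul (Real.hasDerivAt_exp x))
    refine this.congr_deriv ?_
    simp; ring
  have hmono : MonotoneOn (fun x : ℝ => 2 + x - 2 * Real.exp x + x * Real.exp x) (Set.Ici 0) := by
    refine monotoneOn_of_hasDerivWithinAt_nonneg (convex_Ici 0)
      (fun x _ => (hder x).continuousAt.continuousWithinAt)
      (fun x _ => (hder x).hasDerivWithinAt) (fun x _ => ?_)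
    have h1 := Real.add_one_le_exp (-x)
    have h2 : Real.exp (-x) * Real.exp x = 1 := by rw [← Real.exp_add]; simp
    nlinarith [Real.exp_pos x]
  have := hmono (Set.mem_Ici.2 le_rfl) (Set.mem_Ici.2 hl) hl
  simp at this
  linarith

/-- `e^{lx} (e^{-lx} - 1 + lx)`, the integrand in the modified logarithmic Sobolev inequality. -/
noncomputable def entTerm (l x : ℝ) : ℝ := 1 - Real.exp (l * x) + l * x * Real.exp (l * x)

lemma entTerm_nonneg (l x : ℝ) : 0 ≤ entTerm l x := by
  have h1 := Real.add_one_le_exp (-(l * x))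
  have h2 : Real.exp (-(l * x)) * Real.exp (l * x) = 1 := by rw [← Real.exp_add]; simp
  unfold entTerm
  nlinarith [Real.exp_pos (l * x)]

lemma hasDerivAt_linear_mul_exp (A B l x : ℝ) :
    HasDerivAt (fun x => (A * x + B) * Real.exp (l * x))
      ((l * A * x + (A + l * B)) * Real.exp (l * x)) x := by
  have := (((hasDerivAt_id x).const_mul A).add_const B).mul (((hasDerivAt_id x).const_mul l).exp)
  refine this.congr_deriv ?_
  simp; ring

/-- The second derivative test for functions of the form
`(A x + B) e^{lx} + C x² + D x + E` on `(-∞, 1]`. -/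
lemma linear_mul_exp_add_quadratic_nonneg {l A B C D E : ℝ} (hl : 0 ≤ l) (hA : A ≤ 0) (hC : 0 ≤ C)
    (h0 : B + E = 0) (h0' : A + l * B + D = 0) (h0'' : 0 ≤ 2 * l * A + l ^ 2 * B + 2 * C)
    (h1 : (A + B) * Real.exp l + C + D + E = 0) {x : ℝ} (hx : x ≤ 1) :
    0 ≤ (A * x + B) * Real.exp (l * x) + C * x ^ 2 + D * x + E := by
  refine nonneg_of_deriv2_sign
    (R := fun x => (A * x + B) * Real.exp (l * x) + C * x ^ 2 + D * x + E)
    (R₁ := fun x => (l * A * x + (A + l * B)) * Real.exp (l * x) + 2 * C * x + D)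
    (R₂ := fun x => (l * (l * A) * x + (l * A + l * (A + l * B))) * Real.exp (l * x) + 2 * C)
    (fun x => ?_) (fun x => ?_) (fun x y hxy hy => ?_) ?_ ?_ ?_ ?_ hx
  · have := (((hasDerivAt_linear_mul_exp A B l x).add
      (((hasDerivAt_id x).pow 2).const_mul C)).add ((hasDerivAt_id x).const_mul D)).add_const E
    refine this.congr_deriv ?_
    simp; ring
  · have := ((hasDerivAt_linear_mul_exp (l * A) (A + l * B) l x).add
      ((hasDerivAt_id x).const_mul (2 * C))).add_const D
    refine this.congr_deriv ?_
    simp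
  -- `R₂` divided by `e^{lx}` is a nonincreasing linear function plus `2C e^{-lx}`, hence
  -- nonincreasing: once `R₂` is nonnegative at `y`, it is so at every `x ≤ y`.
  · have e1 : Real.exp (l * x) = Real.exp (l * y) * Real.exp (-(l * (y - x))) := by
      rw [← Real.exp_add]; ring_nf
    have e2 : Real.exp (-(l * (y - x))) ≤ 1 := 
      Real.exp_le_one_iff.2 (by nlinarith)
    have hlin : l * (l * A) * y + (l * A + l * (A + l * B)) ≤
        l * (l * A) * x + (l * A + l * (A + l * B)) := by
      nlinarith [mul_nonneg (mul_nonneg hl hl) (mul_nonneg (neg_nonneg.2 hA) (sub_nonneg.2 hxy))]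
    have hp := Real.exp_pos (-(l * (y - x)))
    calc (0 : ℝ) ≤ Real.exp (-(l * (y - x))) *
          ((l * (l * A) * y + (l * A + l * (A + l * B))) * Real.exp (l * y) + 2 * C) :=
          mul_nonneg hp.le hy
      _ = (l * (l * A) * y + (l * A + l * (A + l * B))) * Real.exp (l * x)
          + Real.exp (-(l * (y - x))) * (2 * C) := by rw [e1]; ring
      _ ≤ _ := add_le_add (mul_le_mul_of_nonneg_right hlin (Real.exp_pos _).le)
          (by nlinarith)
  · simp; linarith
  · simp; linarith
  · simp; linarith
  · simp; linarith

/-- Both sides vanish to second order at `0` and agree at `1`, so the second-derivative test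
applies. This and `entTerm_le_quadratic` are the endpoints `α = 0` and `α = 1` of a family affine in
`α`. -/
lemma entTerm_le_linear {l x : ℝ} (hl : 0 ≤ l) (hx : x ≤ 1) :
    (Real.exp l - 1) * entTerm l x ≤ entTerm l 1 * (x * (Real.exp (l * x) - 1)) := by
  have h := linear_mul_exp_add_quadratic_nonneg (l := l) (A := 1 + l - Real.exp l)
    (B := Real.exp l - 1) (C := 0) (D := -entTerm l 1) (E := -(Real.exp l - 1)) hl
    (by linarith [Real.add_one_le_exp l]) le_rfl (by ring) (by simp [entTerm]; ring)
    (by nlinarith [mul_nonneg hl (two_add_le_mul_exp hl)]) (by simp [entTerm]) hx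
  simp only [entTerm, mul_one] at h ⊢
  linarith

lemma entTerm_le_quadratic {l x : ℝ} (hl : 0 ≤ l) (hx : x ≤ 1) :
    Real.exp l * entTerm l x ≤ entTerm l 1 * (x * (Real.exp (l * x) - 1) + x ^ 2) := by
  have h2 : Real.exp (-l) * Real.exp l = 1 := by rw [← Real.exp_add]; simp
  have h := linear_mul_exp_add_quadratic_nonneg (l := l) (A := 1 - Real.exp l)
    (B := Real.exp l) (C := entTerm l 1) (D := -entTerm l 1) (E := -Real.exp l) hl
    (by linarith [Real.one_le_exp hl]) (entTerm_nonneg l 1) (by ring)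
    (by simp [entTerm])
    (by
      have h3 := mul_le_mul_of_nonneg_right (one_add_mul_exp_neg_ge hl) (Real.exp_pos l).le
      rw [mul_assoc, h2] at h3
      simp [entTerm]; nlinarith) (by simp [entTerm]; ring) hx
  simp only [entTerm, mul_one] at h ⊢
  linarith

/-- The elementary inequality behind the entropy bound. -/
lemma entTerm_le {l b x y : ℝ} (hl : 0 ≤ l) (hb : 0 ≤ b) (hx : x ≤ 1) (hyx : y ≤ x) (hyb : y ≤ b) :
    (Real.exp l - 1 + 1 / (1 + b)) * entTerm l x ≤
      entTerm l 1 * (x * Real.exp (l * x) - y + 1 / (1 + b) * y ^ 2) := by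
  have hp := entTerm_nonneg l 1
  have hi := entTerm_le_linear hl hx
  have hii := entTerm_le_quadratic hl hx
  -- Convex combination of the two endpoint inequalities.
  have interp : ∀ α : ℝ, 0 ≤ α → α ≤ 1 → (Real.exp l - 1 + α) * entTerm l x ≤
      entTerm l 1 * (x * Real.exp (l * x) - x + α * x ^ 2) := fun α h0 h1 => by
    nlinarith [mul_le_mul_of_nonneg_left hi (sub_nonneg.2 h1), mul_le_mul_of_nonneg_left hii h0]
  set α := 1 / (1 + b) with hα
  have hα0 : 0 < α := by positivity
  have hαb : α * (1 + b) = 1 := by rw [hα]; field_simp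
  have hα1 : α ≤ 1 := by nlinarith
  -- For `x ≤ b`, passing from `x` to `y` in `-x + α x²` only increases it, because `x + y ≤ 1 + b =
  -- 1/α`.
  rcases le_or_gt x b with hxb | hxb
  · refine (interp α hα0.le hα1).trans (mul_le_mul_of_nonneg_left ?_ hp)
    have : 0 ≤ (x - y) * (1 - α * (x + y)) := by
      refine mul_nonneg (by linarith) ?_
      rw [← hαb]
      nlinarith
    nlinarith
  -- For `x > b` the parameter `β = 1/(1 + x)`, for which `-x + β x² = β - 1`, is interpolated with
  -- `1` to reach `α`. Then `α - 1 ≤ -y + α y²`, the difference being `α (1 - y)(b - y)`.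
  · have hx0 : 0 < x := hb.trans_lt hxb
    have hβ : 0 < 1 / (1 + x) := by positivity
    have hβx : 1 / (1 + x) * (1 + x) = 1 := by field_simp
    have hβ1 : 1 / (1 + x) < 1 := by nlinarith
    have hβα : 1 / (1 + x) ≤ α := by
      rw [hα]; exact one_div_le_one_div_of_le (by linarith) (by linarith)
    have h3 := interp (1 / (1 + x)) hβ.le hβ1.le
    set β := 1 / (1 + x)
    have e3 : - x + β * x ^ 2 = β - 1 := by nlinarith
    have h3' : (Real.exp l - 1 + β) * entTerm l x ≤
        entTerm l 1 * (x * Real.exp (l * x) + (β - 1)) := by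
      rw [← e3]; linarith
    have h4 : (Real.exp l - 1 + 1) * entTerm l x ≤
        entTerm l 1 * (x * Real.exp (l * x) + (1 - 1)) := by
      have : x * (Real.exp (l * x) - 1) + x ^ 2 ≤ x * Real.exp (l * x) + (1 - 1) := by nlinarith
      have := mul_le_mul_of_nonneg_left this hp
      linarith
    have h5 : (Real.exp l - 1 + α) * entTerm l x ≤
        entTerm l 1 * (x * Real.exp (l * x) + (α - 1)) := by
      have hs : 0 < 1 - β := by linarith
      have k1 := mul_le_mul_of_nonneg_left h3' (sub_nonneg.2 hα1)
      have k2 := mul_le_mul_of_nonneg_left h4 (sub_nonneg.2 hβα)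
      refine le_of_mul_le_mul_left ?_ hs
      linarith
    refine h5.trans (mul_le_mul_of_nonneg_left ?_ hp)
    have : 0 ≤ α * ((1 - y) * (b - y)) :=
      mul_nonneg hα0.le (mul_nonneg (by linarith) (by linarith))
    nlinarith

/-- Both sides vanish at `0`, and the derivatives compare through `log(1 + x) ≥ 2x/(x + 2)`. -/
lemma sq_div_le_bennettPhi {x : ℝ} (hx : 0 ≤ x) : x ^ 2 / (2 + 2 * x / 3) ≤ bennettPhi x := by
  have hder : ∀ x : ℝ, 0 ≤ x → HasDerivAt (fun x => bennettPhi x - x ^ 2 / (2 + 2 * x / 3))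
      (Real.log (1 + x) - (2 * x * (2 + 2 * x / 3) - x ^ 2 * (2 / 3)) / (2 + 2 * x / 3) ^ 2) x :=
    fun x hx => by
    have h1 : (1 + x) ≠ 0 := by positivity
    have hl : HasDerivAt (fun x : ℝ => 1 + x) 1 x := (hasDerivAt_id x).const_add 1
    have hd : HasDerivAt (fun x : ℝ => 2 + 2 * x / 3) (2 / 3) x := by
      simpa using (((hasDerivAt_id x).const_mul 2).div_const 3).const_add 2
    have := ((hl.mul (hl.log h1)).sub (hasDerivAt_id x)).sub
      (((hasDerivAt_id x).pow 2).div hd (by positivity))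
    refine this.congr_deriv ?_
    simp
    field_simp
    ring
  have hmono : MonotoneOn (fun x : ℝ => bennettPhi x - x ^ 2 / (2 + 2 * x / 3)) (Set.Ici 0) := by
    refine monotoneOn_of_hasDerivWithinAt_nonneg (convex_Ici 0)
      (fun x hx => (hder x hx).continuousAt.continuousWithinAt)
      (fun x hx => (hder x (interior_subset hx)).hasDerivWithinAt) (fun x hx => ?_)
    have hx0 : 0 ≤ x := interior_subset hx
    refine sub_nonneg.2 (le_trans ?_ (Real.le_log_one_add_of_nonneg hx0))
    rw [div_le_div_iff₀ (by positivity) (by positivity)]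
    nlinarith [pow_nonneg hx0 3]
  have := hmono (Set.mem_Ici.2 le_rfl) (Set.mem_Ici.2 hx) hx
  simp [bennettPhi] at this
  unfold bennettPhi
  linarith

/-! ### Conditional expectations and independent `σ`-algebras -/

section CondExp

variable {Ω ι : Type*} {mΩ : MeasurableSpace Ω} {P : Measure Ω} [IsProbabilityMeasure P]

lemma sup_eq_generateFrom_inter (m₁ m₂ : MeasurableSpace Ω) :
    m₁ ⊔ m₂ = MeasurableSpace.generateFrom
      (Set.image2 (· ∩ ·) {s | MeasurableSet[m₁] s} {s | MeasurableSet[m₂] s}) := by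
  refine le_antisymm (sup_le (fun s hs => ?_) (fun s hs => ?_))
    (MeasurableSpace.generateFrom_le ?_)
  · exact MeasurableSpace.measurableSet_generateFrom
      ⟨s, hs, Set.univ, MeasurableSet.univ, Set.inter_univ s⟩
  · exact MeasurableSpace.measurableSet_generateFrom
      ⟨Set.univ, MeasurableSet.univ, s, hs, Set.univ_inter s⟩
  · rintro _ ⟨s, hs, t, ht, rfl⟩
    exact MeasurableSet.inter ((le_sup_left : m₁ ≤ m₁ ⊔ m₂) s hs)
      ((le_sup_right : m₂ ≤ m₁ ⊔ m₂) t ht)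

lemma isPiSystem_image2_inter (m₁ m₂ : MeasurableSpace Ω) :
    IsPiSystem (Set.image2 (· ∩ ·) {s | MeasurableSet[m₁] s} {s | MeasurableSet[m₂] s}) := by
  rintro _ ⟨s, hs, t, ht, rfl⟩ _ ⟨s', hs', t', ht', rfl⟩ _
  exact ⟨s ∩ s', MeasurableSet.inter hs hs', t ∩ t', MeasurableSet.inter ht ht',
    by simp only [Set.inter_inter_inter_comm]⟩

/-- Enlarging the conditioning by independent information changes nothing. -/
lemma condExp_sup_of_indep {m₁ m₂ m₃ : MeasurableSpace Ω} (h₁₃ : m₁ ≤ m₃) (h₃ : m₃ ≤ mΩ)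
    (h₂ : m₂ ≤ mΩ) (hind : Indep m₃ m₂ P) {g : Ω → ℝ} (hg : StronglyMeasurable[m₃] g)
    (hgi : Integrable g P) : P[g | m₁ ⊔ m₂] =ᵐ[P] P[g | m₁] := by
  have h₁ : m₁ ≤ mΩ := h₁₃.trans h₃
  have hsup : m₁ ⊔ m₂ ≤ mΩ := sup_le h₁ h₂
  -- Independence factors `P(B)` out of integrals over `A ∩ B`, both for `g` and for its conditional
  -- expectation given `m₁`; such sets form a π-system generating `m₁ ⊔ m₂`.
  have key : ∀ {h : Ω → ℝ}, StronglyMeasurable[m₃] h → ∀ {A B : Set Ω}, MeasurableSet[m₁] A →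
      MeasurableSet[m₂] B → ∫ x in A ∩ B, h x ∂P = P.real B * ∫ x in A, h x ∂P := by
    intro h hh A B hA hB
    have hAm : Measurable[m₃] (A.indicator h) := (hh.indicator (h₁₃ A hA)).measurable
    have := Indep.setIntegral_eq_mul (P := P) (X := A.indicator h) (A := B) (f := id) h₂
      (indep_of_indep_of_le_right hind.symm hAm.comap_le)
      (hAm.mono h₃ le_rfl).aemeasurable hB stronglyMeasurable_id.aestronglyMeasurable
    simp only [id] at this
    rw [setIntegral_indicator (h₁ A hA), integral_indicator (h₁ A hA)] at this
    rw [Set.inter_comm, this]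
  symm
  refine ae_eq_condExp_of_forall_setIntegral_eq hsup hgi
    (fun s _ _ => integrable_condExp.integrableOn) (fun s hs _ => ?_)
    ((stronglyMeasurable_condExp (m := m₁) (μ := P) (f := g)).mono
      (le_sup_left : m₁ ≤ m₁ ⊔ m₂)).aestronglyMeasurable
  induction s, hs using MeasurableSpace.induction_on_inter (sup_eq_generateFrom_inter m₁ m₂)
    (isPiSystem_image2_inter m₁ m₂) with
  | empty => simp
  | basic t ht =>
    obtain ⟨A, hA, B, hB, rfl⟩ := ht
    rw [key (stronglyMeasurable_condExp.mono h₁₃) hA hB, key hg hA hB, setIntegral_condExp h₁ hgi hA]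
  | compl t ht ih =>
    have e1 := integral_add_compl (hsup t ht) (integrable_condExp (μ := P) (f := g) (m := m₁))
    have e2 := integral_add_compl (hsup t ht) hgi
    rw [integral_condExp h₁] at e1
    linarith [ih (measure_lt_top P t)]
  | iUnion f hdisj hf ih =>
    rw [integral_iUnion (fun i => hsup _ (hf i)) hdisj integrable_condExp.integrableOn,
      integral_iUnion (fun i => hsup _ (hf i)) hdisj hgi.integrableOn]
    exact tsum_congr fun i => ih i (measure_lt_top P _)

lemma iSup_mem_le {m : ι → MeasurableSpace Ω} (hm : ∀ i, m i ≤ mΩ) (S : Set ι) :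
    ⨆ i ∈ S, m i ≤ mΩ := iSup₂_le fun i _ => hm i

/-- Conditional expectations with respect to subfamilies of an independent family commute. -/
lemma condExp_iSup_mem_eq_inter {m : ι → MeasurableSpace Ω} (hm : ∀ i, m i ≤ mΩ)
    (hind : iIndep m P) (S T : Set ι) {g : Ω → ℝ} (hg : StronglyMeasurable[⨆ i ∈ S, m i] g)
    (hgi : Integrable g P) : P[g | ⨆ i ∈ T, m i] =ᵐ[P] P[g | ⨆ i ∈ S ∩ T, m i] := by
  -- The coordinates in `T \ S` are independent of those in `S` and carry no information about `g`.
  have hT : ⨆ i ∈ T, m i = (⨆ i ∈ S ∩ T, m i) ⊔ ⨆ i ∈ T \ S, m i := by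
    rw [← iSup_union, Set.inter_comm, Set.inter_union_sdiff]
  rw [hT]
  exact condExp_sup_of_indep (biSup_mono fun i hi => hi.1) (iSup_mem_le hm S) (iSup_mem_le hm _)
    (indep_iSup_of_disjoint hm hind Set.disjoint_sdiff_right) hg hgi

lemma integral_mul_condExp_eq {m₁ : MeasurableSpace Ω} (hm : m₁ ≤ mΩ) {h g : Ω → ℝ}
    (hh : StronglyMeasurable[m₁] h) (hhg : Integrable (fun w => h w * g w) P)
    (hg : Integrable g P) : ∫ w, h w * g w ∂P = ∫ w, h w * (P[g | m₁]) w ∂P := by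
  rw [← integral_condExp hm (f := fun w => h w * g w)]
  exact integral_congr_ae (condExp_mul_of_stronglyMeasurable_left hh hhg hg)

lemma condExp_le_const {m₁ : MeasurableSpace Ω} (hm : m₁ ≤ mΩ) {g : Ω → ℝ} {C : ℝ}
    (hg : Integrable g P) (h : ∀ᵐ w ∂P, g w ≤ C) : ∀ᵐ w ∂P, (P[g | m₁]) w ≤ C := by
  have := condExp_mono (m := m₁) hg (integrable_const C) h
  rwa [condExp_const hm] at this

/-- If a function of independent variables exceeds each of its partial averages by at most `1`,
then it is bounded above. -/
lemma ae_le_card_add_integral [Fintype ι] {m : ι → MeasurableSpace Ω}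
    (hm : ∀ i, m i ≤ mΩ) (hind : iIndep m P) {Z : Ω → ℝ}
    (hZ : StronglyMeasurable[⨆ i ∈ (Set.univ : Set ι), m i] Z) (hZi : Integrable Z P)
    (hstep : ∀ i, ∀ᵐ w ∂P, Z w ≤ 1 + (P[Z | ⨆ j ∈ ({i}ᶜ : Set ι), m j]) w) :
    ∀ᵐ w ∂P, Z w ≤ Fintype.card ι + ∫ w', Z w' ∂P := by
  classical
  -- Coordinates are averaged out one at a time. Each costs at most `1`, because averaging `P[Z |
  -- {i}ᶜ]` over `s` gives the average of `Z` over `insert i s`.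
  have main : ∀ s : Finset ι,
      ∀ᵐ w ∂P, Z w ≤ s.card + (P[Z | ⨆ j ∈ ((s : Set ι)ᶜ), m j]) w := by
    intro s
    induction s using Finset.induction_on with
    | empty =>
      rw [Finset.coe_empty, Set.compl_empty, condExp_of_stronglyMeasurable (iSup_mem_le hm _) hZ hZi]
      simp
    | insert i s hi ih =>
      have hset : ((insert i s : Finset ι) : Set ι)ᶜ = {i}ᶜ ∩ (s : Set ι)ᶜ := by
        ext; simp
      have h1 := condExp_mono (m := ⨆ j ∈ ((s : Set ι)ᶜ), m j) hZi
        ((integrable_const (1 : ℝ)).add integrable_condExp) (hstep i)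
      have h2 := condExp_add (μ := P) (integrable_const (1 : ℝ))
        (integrable_condExp (μ := P) (f := Z) (m := ⨆ j ∈ ({i}ᶜ : Set ι), m j))
        (⨆ j ∈ ((s : Set ι)ᶜ), m j)
      have h3 := condExp_iSup_mem_eq_inter hm hind {i}ᶜ ((s : Set ι)ᶜ)
        (stronglyMeasurable_condExp (μ := P) (f := Z) (m := ⨆ j ∈ ({i}ᶜ : Set ι), m j))
        integrable_condExp
      have h4 := condExp_condExp_of_le (μ := P) (f := Z)
        (biSup_mono fun j hj => hj.1 :
          ⨆ j ∈ ({i}ᶜ ∩ (s : Set ι)ᶜ), m j ≤ ⨆ j ∈ ({i}ᶜ : Set ι), m j) (iSup_mem_le hm _)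
      rw [hset, Finset.card_insert_of_notMem hi]
      filter_upwards [ih, h1, h2, h3, h4] with w e0 e1 e2 e3 e4
      rw [condExp_const (iSup_mem_le hm _)] at e2
      simp only [Pi.add_apply] at e2
      push_cast
      have e5 := e1.trans_eq e2
      rw [e3, e4] at e5
      linarith
  have h := main Finset.univ
  simp only [Finset.coe_univ, Set.compl_univ, Set.mem_empty_iff_false, iSup_false, iSup_bot,
    Finset.card_univ] at h
  rwa [condExp_bot] at h

end CondExp

/-! ### The entropy inequality -/

section Entropy

variable {Ω ι : Type*} {mΩ : MeasurableSpace Ω} {P : Measure Ω} [IsProbabilityMeasure P]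
  {m : ι → MeasurableSpace Ω}

lemma integrable_exp_of_ae_le {U : Ω → ℝ} {B : ℝ} (hU : AEMeasurable U P)
    (hB : ∀ᵐ w ∂P, U w ≤ B) : Integrable (fun w => Real.exp (U w)) P := by
  refine Integrable.of_bound (Real.measurable_exp.comp_aemeasurable hU).aestronglyMeasurable
    (Real.exp B) ?_
  filter_upwards [hB] with w hw
  rw [Real.norm_eq_abs, Real.abs_exp]
  exact Real.exp_le_exp.2 hw

lemma abs_log_le_of_mem_Icc {x a c : ℝ} (ha : 0 < a) (h1 : a ≤ x) (h2 : x ≤ c) :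
    |Real.log x| ≤ |Real.log a| + |Real.log c| := by
  have l1 := Real.log_le_log ha h1
  have l2 := Real.log_le_log (ha.trans_le h1) h2
  rw [abs_le]
  constructor
  · linarith [neg_abs_le (Real.log a), abs_nonneg (Real.log c)]
  · linarith [le_abs_self (Real.log c), abs_nonneg (Real.log a)]

/-- The contribution of one variable to the entropy of `e^U`; the conditional expectations are
shifted by `ε` to keep the logarithms bounded. -/
lemma integral_exp_mul_log_condExp_sub_le (hm : ∀ i, m i ≤ mΩ) (hind : iIndep m P) {U V : Ω → ℝ}
    {B ε : ℝ} (hε : 0 < ε) (hU : Measurable U) (hUi : Integrable U P) (hUB : ∀ᵐ w ∂P, U w ≤ B)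
    (S : Set ι) (i : ι) (hV : Measurable[⨆ j ∈ ({i}ᶜ : Set ι), m j] V) (hVi : Integrable V P)
    (hVB : ∀ᵐ w ∂P, V w ≤ B) :
    ∫ w, Real.exp (U w) * Real.log ((P[fun w => Real.exp (U w) | ⨆ j ∈ S, m j]) w + ε) ∂P
      - ∫ w, Real.exp (U w) *
          Real.log ((P[fun w => Real.exp (U w) | ⨆ j ∈ S ∩ {i}ᶜ, m j]) w + ε) ∂P
      ≤ ∫ w, (Real.exp (U w) * (U w - V w) - Real.exp (U w) + Real.exp (V w)) ∂P := by
  set W : Ω → ℝ := fun w => Real.exp (U w) with hW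
  have hWm : Measurable W := Real.measurable_exp.comp hU
  have hWi : Integrable W P := integrable_exp_of_ae_le hU.aemeasurable hUB
  have hWC : ∀ᵐ w ∂P, W w ≤ Real.exp B := by
    filter_upwards [hUB] with w hw using Real.exp_le_exp.2 hw
  have hFi := iSup_mem_le hm ({i}ᶜ : Set ι)
  have hVm : Measurable V := hV.mono hFi le_rfl
  have hexpV : Integrable (fun w => Real.exp (V w)) P :=
    integrable_exp_of_ae_le hVm.aemeasurable hVB
  -- bounds on the shifted conditional expectations
  have hbd : ∀ T : Set ι, ∀ᵐ w ∂P, ε ≤ (P[W | ⨆ j ∈ T, m j]) w + ε ∧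
      (P[W | ⨆ j ∈ T, m j]) w + ε ≤ Real.exp B + ε := fun T => by
    have h0 : 0 ≤ᵐ[P] P[W | ⨆ j ∈ T, m j] :=
      condExp_nonneg (Filter.Eventually.of_forall fun w => (Real.exp_pos _).le)
    filter_upwards [h0, condExp_le_const (iSup_mem_le hm T) hWi hWC] with w h0 h1
    simp only [Pi.zero_apply] at h0
    constructor <;> linarith
  have hmeas : ∀ T : Set ι, StronglyMeasurable[⨆ j ∈ T, m j]
      (fun w => (P[W | ⨆ j ∈ T, m j]) w + ε) := fun T =>
    stronglyMeasurable_condExp.add stronglyMeasurable_const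
  have hlogi : ∀ T : Set ι, Integrable (fun w => W w *
      Real.log ((P[W | ⨆ j ∈ T, m j]) w + ε)) P := fun T => by
    have hlm : Measurable (fun w => Real.log ((P[W | ⨆ j ∈ T, m j]) w + ε)) :=
      Real.measurable_log.comp ((hmeas T).mono (iSup_mem_le hm T)).measurable
    have := hWi.bdd_mul (c := |Real.log ε| + |Real.log (Real.exp B + ε)|)
      hlm.aestronglyMeasurable (by
        filter_upwards [hbd T] with w hw
        exact abs_log_le_of_mem_Icc hε hw.1 hw.2)
    simpa only [mul_comm] using this
  set A : Ω → ℝ := fun w => (P[W | ⨆ j ∈ S, m j]) w + ε with hA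
  set A' : Ω → ℝ := fun w => (P[W | ⨆ j ∈ S ∩ {i}ᶜ, m j]) w + ε with hA'
  have hAi : Integrable A P := integrable_condExp.add (integrable_const ε)
  -- `h A = e^V A/A'` plays the role of `e^V`: by `hT` it has the same integral, since `h` does not
  -- involve coordinate `i` and averaging `A` over that coordinate gives `A'`.
  set h : Ω → ℝ := fun w => Real.exp (V w) * (A' w)⁻¹ with hh
  have hle : ⨆ j ∈ S ∩ {i}ᶜ, m j ≤ ⨆ j ∈ ({i}ᶜ : Set ι), m j := biSup_mono fun j hj => hj.2
  have hhm : StronglyMeasurable[⨆ j ∈ ({i}ᶜ : Set ι), m j] h :=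
    ((Real.measurable_exp.comp hV).mul
      (((hmeas (S ∩ {i}ᶜ)).mono hle).measurable.inv)).stronglyMeasurable
  have hhAi : Integrable (fun w => h w * A w) P := by
    refine hAi.bdd_mul (c := Real.exp B * ε⁻¹) (hhm.mono hFi).aestronglyMeasurable ?_
    filter_upwards [hbd (S ∩ {i}ᶜ), hVB] with w hw hv
    rw [Real.norm_eq_abs, abs_mul, Real.abs_exp, abs_inv, abs_of_pos (hε.trans_le hw.1)]
    exact mul_le_mul (Real.exp_le_exp.2 hv) (inv_anti₀ hε hw.1)
      (inv_nonneg.2 (hε.trans_le hw.1).le) (Real.exp_pos _).le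
  have hcond : P[A | ⨆ j ∈ ({i}ᶜ : Set ι), m j] =ᵐ[P] A' := by
    have e1 := condExp_iSup_mem_eq_inter hm hind S {i}ᶜ (hmeas S) hAi
    have e2 := condExp_add (μ := P) (integrable_condExp (μ := P) (f := W) (m := ⨆ j ∈ S, m j))
      (integrable_const ε) (⨆ j ∈ S ∩ {i}ᶜ, m j)
    have e3 := condExp_condExp_of_le (μ := P) (f := W)
      (biSup_mono fun j hj => hj.1 : ⨆ j ∈ S ∩ {i}ᶜ, m j ≤ ⨆ j ∈ S, m j) (iSup_mem_le hm S)
    refine e1.trans (e2.trans ?_)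
    filter_upwards [e3] with w e3
    rw [Pi.add_apply, e3, condExp_const (iSup_mem_le hm _)]
  have hT : ∫ w, h w * A w ∂P = ∫ w, Real.exp (V w) ∂P := by
    rw [integral_mul_condExp_eq hFi hhm hhAi hAi]
    refine integral_congr_ae ?_
    filter_upwards [hcond, hbd (S ∩ {i}ᶜ)] with w hw hb
    rw [hw]
    exact inv_mul_cancel_right₀ (hε.trans_le hb.1).ne' _
  have hWUV : Integrable (fun w => W w * (U w - V w)) P := by
    refine (hUi.sub hVi).bdd_mul (c := Real.exp B) hWm.aestronglyMeasurable ?_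
    filter_upwards [hWC] with w hw
    rwa [Real.norm_eq_abs, hW, Real.abs_exp]
  have hdi : Integrable (fun w => W w * (U w - V w) - W w) P := hWUV.sub hWi
  have hsplit : ∫ w, (W w * (U w - V w) - W w + Real.exp (V w)) ∂P
      = ∫ w, (W w * (U w - V w) - W w + h w * A w) ∂P := by
    rw [integral_add hdi hexpV, integral_add hdi hhAi, hT]
  rw [← integral_sub (hlogi S) (hlogi (S ∩ {i}ᶜ)), hsplit]
  refine integral_mono_ae ((hlogi S).sub (hlogi _)) (hdi.add hhAi) ?_
  filter_upwards [hbd S, hbd (S ∩ {i}ᶜ)] with w h1 h2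
  have hAp : 0 < A w := hε.trans_le h1.1
  have hAp' : 0 < A' w := hε.trans_le h2.1
  have hexp : W w * Real.exp (Real.log (A w) - Real.log (A' w) + V w - U w) = h w * A w := by
    simp only [hW, hh]
    rw [← Real.exp_add, show U w + (Real.log (A w) - Real.log (A' w) + V w - U w)
      = V w + (Real.log (A w) - Real.log (A' w)) by ring, Real.exp_add, Real.exp_sub,
      Real.exp_log hAp, Real.exp_log hAp']
    field_simp
  -- The variational step: `1 + z ≤ e^z` with `z = log(A/A') + V - U`, multiplied by `e^U`.
  have := mul_le_mul_of_nonneg_left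
    (Real.add_one_le_exp (Real.log (A w) - Real.log (A' w) + V w - U w)) (Real.exp_pos (U w)).le
  change W w * _ ≤ W w * _ at this
  rw [hexp] at this
  change W w * Real.log (A w) - W w * Real.log (A' w) ≤ W w * (U w - V w) - W w + h w * A w
  linarith

/-- The modified logarithmic Sobolev inequality for functions of independent variables. -/
lemma entropy_exp_le [Fintype ι] (hm : ∀ i, m i ≤ mΩ) (hind : iIndep m P) {U : Ω → ℝ}
    {V : ι → Ω → ℝ} {B : ℝ} (hU : Measurable[⨆ j ∈ (Set.univ : Set ι), m j] U)
    (hUi : Integrable U P) (hUB : ∀ᵐ w ∂P, U w ≤ B)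
    (hV : ∀ i, Measurable[⨆ j ∈ ({i}ᶜ : Set ι), m j] (V i)) (hVi : ∀ i, Integrable (V i) P)
    (hVB : ∀ i, ∀ᵐ w ∂P, V i w ≤ B) :
    ∫ w, Real.exp (U w) * U w ∂P
      - (∫ w, Real.exp (U w) ∂P) * Real.log (∫ w, Real.exp (U w) ∂P)
      ≤ ∑ i, ∫ w, (Real.exp (U w) * (U w - V i w) - Real.exp (U w) + Real.exp (V i w)) ∂P := by
  classical
  have hUm : Measurable U := hU.mono (iSup_mem_le hm _) le_rfl
  set W : Ω → ℝ := fun w => Real.exp (U w) with hW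
  have hWm : Measurable W := Real.measurable_exp.comp hUm
  have hWi : Integrable W P := integrable_exp_of_ae_le hUm.aemeasurable hUB
  have hWC : ∀ᵐ w ∂P, W w ≤ Real.exp B := by
    filter_upwards [hUB] with w hw using Real.exp_le_exp.2 hw
  have hWU : Integrable (fun w => W w * U w) P := by
    refine hUi.bdd_mul (c := Real.exp B) hWm.aestronglyMeasurable ?_
    filter_upwards [hWC] with w hw
    rwa [Real.norm_eq_abs, hW, Real.abs_exp]
  have hpos : 0 < ∫ w, W w ∂P := integral_exp_pos hWi
  have hshift : ∀ ε : ℝ, 0 < ε → ∫ w, W w * U w ∂P - (∫ w, W w ∂P) * Real.log (∫ w, W w ∂P + ε)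
      ≤ ∑ i, ∫ w, (W w * (U w - V i w) - W w + Real.exp (V i w)) ∂P := fun ε hε => by
    -- The entropy telescopes as the coordinates of `s` are integrated out successively, from full
    -- information (where the conditional expectation is `W`) to none (where it is the mean).
    have main : ∀ s : Finset ι,
        ∫ w, W w * Real.log ((P[W | ⨆ j ∈ (Set.univ : Set ι), m j]) w + ε) ∂P
        - ∫ w, W w * Real.log ((P[W | ⨆ j ∈ ((s : Set ι)ᶜ), m j]) w + ε) ∂P
        ≤ ∑ i ∈ s, ∫ w, (W w * (U w - V i w) - W w + Real.exp (V i w)) ∂P := by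
      intro s
      induction s using Finset.induction_on with
      | empty => simp
      | insert i s hi ih =>
        have hset : ((insert i s : Finset ι) : Set ι)ᶜ = (s : Set ι)ᶜ ∩ {i}ᶜ := by
          ext; simp [and_comm]
        rw [Finset.sum_insert hi, hset]
        have := integral_exp_mul_log_condExp_sub_le hm hind hε hUm hUi hUB (s : Set ι)ᶜ i
          (hV i) (hVi i) (hVB i)
        linarith
    have h := main Finset.univ
    have hWs : StronglyMeasurable[⨆ j ∈ (Set.univ : Set ι), m j] W :=
      (Real.measurable_exp.comp hU).stronglyMeasurable
    rw [condExp_of_stronglyMeasurable (iSup_mem_le hm _) hWs hWi] at h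
    simp only [Finset.coe_univ, Set.compl_univ, Set.mem_empty_iff_false, iSup_false, iSup_bot] at h
    rw [condExp_bot, integral_mul_const] at h
    refine le_trans (sub_le_sub_right ?_ _) h
    refine integral_mono_ae hWU ?_ (Filter.Eventually.of_forall fun w => ?_)
    · have hlm : Measurable (fun w => Real.log (W w + ε)) :=
        Real.measurable_log.comp (hWm.add_const ε)
      have := hWi.bdd_mul (c := |Real.log ε| + |Real.log (Real.exp B + ε)|)
        hlm.aestronglyMeasurable (by
          filter_upwards [hWC] with w hw
          exact abs_log_le_of_mem_Icc hε (by linarith [Real.exp_pos (U w)]) (by linarith))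
      simpa only [mul_comm] using this
    · refine mul_le_mul_of_nonneg_left ?_ (Real.exp_pos _).le
      rw [← Real.log_exp (U w)]
      exact Real.log_le_log (Real.exp_pos _) (by simp only [hW]; linarith)
  -- The shift disappears as `ε → 0`, as the logarithm is continuous at the positive mean of `W`.
  have hlim : Filter.Tendsto (fun ε : ℝ => ∫ w, W w * U w ∂P -
      (∫ w, W w ∂P) * Real.log (∫ w, W w ∂P + ε)) (nhdsWithin 0 (Set.Ioi 0))
      (nhds (∫ w, W w * U w ∂P - (∫ w, W w ∂P) * Real.log (∫ w, W w ∂P))) := by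
    have hc : ContinuousAt (fun ε : ℝ => ∫ w, W w * U w ∂P -
        (∫ w, W w ∂P) * Real.log (∫ w, W w ∂P + ε)) 0 :=
      continuousAt_const.sub (continuousAt_const.mul
        ((continuousAt_const.add continuousAt_id).log (by simpa using hpos.ne')))
    have := hc.tendsto
    rw [add_zero] at this
    exact this.mono_left nhdsWithin_le_nhds
  exact le_of_tendsto hlim (by filter_upwards [self_mem_nhdsWithin] with ε hε using hshift ε hε)

end Entropy

/-! ### Bousquet's inequality for sub-additive functions of independent variables -/

lemma exp_le_one_add_add_sq {u : ℝ} (hu : u ≤ 1) : Real.exp u ≤ 1 + u + u ^ 2 := by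
  rcases le_or_gt (-1) u with h | h
  · have := Real.abs_exp_sub_one_sub_id_le (abs_le.2 ⟨h, hu⟩)
    linarith [le_abs_self (Real.exp u - 1 - u)]
  · have := Real.exp_le_one_iff.2 (by linarith : u ≤ 0)
    nlinarith

/-- Integration of the differential inequality for the logarithmic moment generating function. -/
lemma le_of_entropy_differential_inequality {M M' : ℝ → ℝ} {α E s v C δ : ℝ} (hα : 0 < α)
    (hv0 : 0 ≤ v) (hδ : 0 < δ) (hM : ∀ l, 0 < l → HasDerivAt M (M' l) l)
    (hineq : ∀ l, 0 < l →
      (Real.exp l - 1 + α) * (l * M' l - M l) ≤ entTerm l 1 * (M' l + α * s))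
    (hv : v * α = E + α * s) (h0 : ∀ l, 0 < l → l < δ → M l ≤ l * E + C * l ^ 2)
    {l : ℝ} (hl : 0 < l) : M l ≤ l * E + v * (Real.exp l - l - 1) := by
  -- An integrating factor: `x w' - w = entTerm x 1`, so the hypothesis reads `w M' - w' M ≤ α s ·
  -- entTerm x 1`. The claimed bound solves the equality case, whence the difference `Lf` has `Lf /
  -- w` nonincreasing.
  set w : ℝ → ℝ := fun x => Real.exp x - x - 1 + α * x with hw
  have hg : ∀ x : ℝ, 0 ≤ Real.exp x - x - 1 := fun x => by linarith [Real.add_one_le_exp x]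
  have hwpos : ∀ x, 0 < x → 0 < w x := fun x hx => by
    have := hg x
    have := mul_pos hα hx
    simp only [hw]; linarith
  have hgd : ∀ x : ℝ, HasDerivAt (fun x => Real.exp x - x - 1) (Real.exp x - 1) x := fun x =>
    ((Real.hasDerivAt_exp x).sub (hasDerivAt_id x)).sub_const 1
  have hwd : ∀ x : ℝ, HasDerivAt w (Real.exp x - 1 + α) x := fun x => by
    have := (hgd x).add ((hasDerivAt_id x).const_mul α)
    exact this.congr_deriv (by simp)
  set Lf : ℝ → ℝ := fun x => M x - (x * E + v * (Real.exp x - x - 1)) with hLf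
  have hLd : ∀ x, 0 < x → HasDerivAt Lf (M' x - (E + v * (Real.exp x - 1))) x := fun x hx => by
    have := (hM x hx).sub (((hasDerivAt_id x).mul_const E).add ((hgd x).const_mul v))
    exact this.congr_deriv (by simp)
  have hanti : AntitoneOn (fun x => Lf x / w x) (Set.Ioi 0) := by
    have hd : ∀ x, 0 < x → HasDerivAt (fun x => Lf x / w x)
        (((M' x - (E + v * (Real.exp x - 1))) * w x - Lf x * (Real.exp x - 1 + α)) / w x ^ 2) x :=
      fun x hx => (hLd x hx).div (hwd x) (hwpos x hx).ne'
    refine antitoneOn_of_hasDerivWithinAt_nonpos (convex_Ioi 0)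
      (fun x hx => (hd x hx).continuousAt.continuousWithinAt)
      (fun x hx => (hd x (interior_subset hx)).hasDerivWithinAt) (fun x hx => ?_)
    refine div_nonpos_of_nonpos_of_nonneg ?_ (sq_nonneg _)
    have h1 := hineq x (interior_subset hx)
    have hE : E = v * α - α * s := by linarith
    have key : (M' x - (E + v * (Real.exp x - 1))) * w x - Lf x * (Real.exp x - 1 + α)
        = (Real.exp x - 1 + α) * (x * M' x - M x) - entTerm x 1 * (M' x + α * s) := by
      simp only [hw, hLf, entTerm, hE]; ring_nf
    rw [key]; linarith
  have hlim : Filter.Tendsto (fun ε : ℝ => |C| * ε / α) (nhdsWithin 0 (Set.Ioi 0)) (nhds 0) := by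
    have : Continuous (fun ε : ℝ => |C| * ε / α) := by fun_prop
    have h := this.tendsto 0
    simp only [mul_zero, zero_div] at h
    exact h.mono_left nhdsWithin_le_nhds
  -- Near `0`, `Lf` is at most of order `ε²` while `w ≥ α ε`, so the nonincreasing quotient has
  -- limit at most `0` there.
  have hQ : Lf l / w l ≤ 0 := by
    refine ge_of_tendsto hlim ?_
    have hmem : Set.Ioo 0 (min δ l) ∈ nhdsWithin (0 : ℝ) (Set.Ioi 0) :=
      Ioo_mem_nhdsGT (lt_min hδ hl)
    filter_upwards [hmem] with ε hε
    have hεpos : 0 < ε := hε.1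
    refine (hanti (Set.mem_Ioi.2 hεpos) (Set.mem_Ioi.2 hl) (hε.2.le.trans (min_le_right _ _))).trans ?_
    change Lf ε / w ε ≤ _
    have h1 := h0 ε hεpos (hε.2.trans_le (min_le_left _ _))
    have h2 : Lf ε ≤ |C| * ε ^ 2 := by
      have := mul_nonneg hv0 (hg ε)
      have := mul_le_mul_of_nonneg_right (le_abs_self C) (sq_nonneg ε)
      simp only [hLf]; linarith
    have h3 : α * ε ≤ w ε := by simp only [hw]; linarith [hg ε]
    rw [div_le_div_iff₀ (hwpos ε hεpos) hα]
    calc Lf ε * α ≤ |C| * ε ^ 2 * α := mul_le_mul_of_nonneg_right h2 hα.le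
      _ = |C| * ε * (α * ε) := by ring
      _ ≤ |C| * ε * w ε := mul_le_mul_of_nonneg_left h3 (by positivity)
  have := (div_le_iff₀ (hwpos l hl)).1 hQ
  simp only [hLf] at this
  linarith

lemma condExp_sq_nonneg {Ω : Type*} {mΩ : MeasurableSpace Ω} {P : Measure Ω}
    (m : MeasurableSpace Ω) (g : Ω → ℝ) : ∀ᵐ w ∂P, 0 ≤ (P[fun w' => g w' ^ 2 | m]) w :=
  condExp_nonneg (Filter.Eventually.of_forall fun _ => sq_nonneg _)

/-- The hypotheses of Bousquet's inequality: `Z` is a function of independent `σ`-algebras `m i`,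
`Zd i` does not depend on `m i`, and the `Z - Zd i` add up to at most `Z`. -/
structure BousquetHyp {Ω ι : Type*} [Fintype ι] {mΩ : MeasurableSpace Ω}
    (m : ι → MeasurableSpace Ω) (P : Measure Ω) (Z : Ω → ℝ) (Zd Y : ι → Ω → ℝ) (b σsq : ℝ) :
    Prop where
  le : ∀ i, m i ≤ mΩ
  indep : iIndep m P
  measurable_Z : Measurable[⨆ j ∈ (Set.univ : Set ι), m j] Z
  integrable_Z : Integrable Z P
  measurable_Zd : ∀ i, Measurable[⨆ j ∈ ({i}ᶜ : Set ι), m j] (Zd i)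
  sum_le : ∀ᵐ w ∂P, ∑ i, (Z w - Zd i w) ≤ Z w
  memLp_Y : ∀ i, MemLp (Y i) 2 P
  Y_le_sub : ∀ i, ∀ᵐ w ∂P, Y i w ≤ Z w - Zd i w
  sub_le_one : ∀ i, ∀ᵐ w ∂P, Z w - Zd i w ≤ 1
  condExp_Y_nonneg : ∀ i, ∀ᵐ w ∂P, 0 ≤ (P[Y i | ⨆ j ∈ ({i}ᶜ : Set ι), m j]) w
  Y_le : ∀ i, ∀ᵐ w ∂P, Y i w ≤ b
  sum_condExp_sq_le : ∀ᵐ w ∂P,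
    ∑ i, (P[fun w' => Y i w' ^ 2 | ⨆ j ∈ ({i}ᶜ : Set ι), m j]) w ≤ σsq

namespace BousquetHyp

variable {Ω ι : Type*} [Fintype ι] {mΩ : MeasurableSpace Ω} {P : Measure Ω}
  {m : ι → MeasurableSpace Ω} {Z : Ω → ℝ} {Zd Y : ι → Ω → ℝ} {b σsq : ℝ}

lemma aestronglyMeasurable_Zd (h : BousquetHyp m P Z Zd Y b σsq) (i : ι) :
    AEStronglyMeasurable (Zd i) P :=
  ((h.measurable_Zd i).mono (iSup_mem_le h.le _) le_rfl).aestronglyMeasurable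

lemma ae_sum_Y_le (h : BousquetHyp m P Z Zd Y b σsq) : ∀ᵐ w ∂P, ∑ i, Y i w ≤ Z w := by
  filter_upwards [h.sum_le, ae_all_iff.2 h.Y_le_sub] with w h1 h2
  exact (Finset.sum_le_sum fun i _ => h2 i).trans h1

lemma measurable_Z' (h : BousquetHyp m P Z Zd Y b σsq) : Measurable Z :=
  h.measurable_Z.mono (iSup_mem_le h.le _) le_rfl

lemma stronglyMeasurable_exp_Zd (h : BousquetHyp m P Z Zd Y b σsq) (l : ℝ) (i : ι) :
    StronglyMeasurable[⨆ j ∈ ({i}ᶜ : Set ι), m j] (fun w => Real.exp (l * Zd i w)) :=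
  (Real.measurable_exp.comp ((h.measurable_Zd i).const_mul l)).stronglyMeasurable

variable [IsProbabilityMeasure P]

lemma integrable_Y (h : BousquetHyp m P Z Zd Y b σsq) (i : ι) : Integrable (Y i) P :=
  (h.memLp_Y i).integrable (by norm_num)

lemma integrable_Zd (h : BousquetHyp m P Z Zd Y b σsq) (i : ι) : Integrable (Zd i) P := by
  have : Integrable (fun w => |Y i w| + 1 + |Z w|) P :=
    ((h.integrable_Y i).abs.add (integrable_const 1)).add h.integrable_Z.abs
  refine this.mono' (h.aestronglyMeasurable_Zd i) ?_
  filter_upwards [h.Y_le_sub i, h.sub_le_one i] with w h1 h2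
  rw [Real.norm_eq_abs, abs_le]
  constructor
  · linarith [neg_abs_le (Z w), abs_nonneg (Y i w)]
  · linarith [le_abs_self (Z w), neg_abs_le (Y i w)]

/-- Take conditional expectations in `Zd i ≤ Z - Y i` and drop the nonnegative `E_i[Y i]`. -/
lemma Zd_le_condExp (h : BousquetHyp m P Z Zd Y b σsq) (i : ι) :
    ∀ᵐ w ∂P, Zd i w ≤ (P[Z | ⨆ j ∈ ({i}ᶜ : Set ι), m j]) w := by
  have h1 := condExp_mono (m := ⨆ j ∈ ({i}ᶜ : Set ι), m j) (h.integrable_Zd i)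
    (h.integrable_Z.sub (h.integrable_Y i))
    (by filter_upwards [h.Y_le_sub i] with w hw; simp only [Pi.sub_apply]; linarith)
  rw [condExp_of_stronglyMeasurable (iSup_mem_le h.le _) (h.measurable_Zd i).stronglyMeasurable
    (h.integrable_Zd i)] at h1
  filter_upwards [h1, condExp_sub h.integrable_Z (h.integrable_Y i) (⨆ j ∈ ({i}ᶜ : Set ι), m j),
    h.condExp_Y_nonneg i] with w e1 e2 e3
  rw [e2, Pi.sub_apply] at e1
  linarith

/-- `Z` and the `Zd i` are bounded above. -/
lemma exists_ae_le (h : BousquetHyp m P Z Zd Y b σsq) :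
    ∃ B, (∀ᵐ w ∂P, Z w ≤ B) ∧ ∀ i, ∀ᵐ w ∂P, Zd i w ≤ B := by
  -- `Z ≤ 1 + Zd i ≤ 1 + E_i[Z]`, so an upper bound on `Z` follows although only its increments are
  -- assumed bounded.
  have hB := ae_le_card_add_integral h.le h.indep h.measurable_Z.stronglyMeasurable h.integrable_Z
    (fun i => by
      filter_upwards [h.Zd_le_condExp i, h.sub_le_one i] with w h1 h2
      linarith)
  refine ⟨_, hB, fun i => ?_⟩
  filter_upwards [h.Zd_le_condExp i, condExp_le_const (iSup_mem_le h.le ({i}ᶜ : Set ι))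
    h.integrable_Z hB] with w h1 h2 using h1.trans h2

/-- `E Z ≥ ∑ E Y_i ≥ 0`, by sub-additivity and `E_i[Y_i] ≥ 0`. -/
lemma integral_Z_nonneg (h : BousquetHyp m P Z Zd Y b σsq) : 0 ≤ ∫ w, Z w ∂P := by
  have h1 := integral_mono_ae (integrable_finsetSum Finset.univ fun i _ => h.integrable_Y i)
    h.integrable_Z (by filter_upwards [h.ae_sum_Y_le] with w hw using hw)
  rw [integral_finsetSum _ fun i _ => h.integrable_Y i] at h1
  refine le_trans (Finset.sum_nonneg fun i _ => ?_) h1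
  rw [← integral_condExp (iSup_mem_le h.le ({i}ᶜ : Set ι))]
  exact integral_nonneg_of_ae (h.condExp_Y_nonneg i)

lemma sigmaSq_nonneg (h : BousquetHyp m P Z Zd Y b σsq) : 0 ≤ σsq := by
  obtain ⟨w, h1, h2⟩ := (h.sum_condExp_sq_le.and
    (ae_all_iff.2 fun i => condExp_sq_nonneg (P := P) (⨆ j ∈ ({i}ᶜ : Set ι), m j) (Y i))).exists
  exact (Finset.sum_nonneg fun i _ => h2 i).trans h1

/-- `Z` lies between the square-integrable `∑ Y_i` and a constant. -/
lemma memLp_Z (h : BousquetHyp m P Z Zd Y b σsq) : MemLp Z 2 P := by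
  obtain ⟨B, hB, -⟩ := h.exists_ae_le
  have hs : MemLp (fun w => ∑ i, Y i w) 2 P := memLp_finsetSum _ fun i _ => h.memLp_Y i
  have hc : MemLp (fun _ : Ω => |B|) 2 P := memLp_const |B|
  have h1 : MemLp (fun w => |B| + |∑ i, Y i w|) 2 P := hc.add hs.norm
  refine h1.of_le h.integrable_Z.aestronglyMeasurable ?_
  filter_upwards [hB, h.ae_sum_Y_le] with w e1 e2
  refine le_trans ?_ (le_abs_self _)
  rw [Real.norm_eq_abs, abs_le]
  constructor
  · linarith [neg_abs_le (∑ i, Y i w), abs_nonneg B]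
  · linarith [le_abs_self B, abs_nonneg (∑ i, Y i w)]

lemma integrable_exp (h : BousquetHyp m P Z Zd Y b σsq) {l : ℝ} (hl : 0 ≤ l) :
    Integrable (fun w => Real.exp (l * Z w)) P := by
  obtain ⟨B, hB, -⟩ := h.exists_ae_le
  refine integrable_exp_of_ae_le (B := l * B) (h.measurable_Z'.const_mul l).aemeasurable ?_
  filter_upwards [hB] with w hw using mul_le_mul_of_nonneg_left hw hl

lemma ae_norm_exp_Zd_le (h : BousquetHyp m P Z Zd Y b σsq) {l : ℝ} (hl : 0 ≤ l) (i : ι) :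
    ∃ C, ∀ᵐ w ∂P, ‖Real.exp (l * Zd i w)‖ ≤ C := by
  obtain ⟨B, -, hB⟩ := h.exists_ae_le
  refine ⟨Real.exp (l * B), ?_⟩
  filter_upwards [hB i] with w hw
  rw [Real.norm_eq_abs, Real.abs_exp]
  exact Real.exp_le_exp.2 (mul_le_mul_of_nonneg_left hw hl)

lemma ae_norm_exp_Z_le (h : BousquetHyp m P Z Zd Y b σsq) {l : ℝ} (hl : 0 ≤ l) :
    ∃ C, ∀ᵐ w ∂P, ‖Real.exp (l * Z w)‖ ≤ C := by
  obtain ⟨B, hB, -⟩ := h.exists_ae_le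
  refine ⟨Real.exp (l * B), ?_⟩
  filter_upwards [hB] with w hw
  rw [Real.norm_eq_abs, Real.abs_exp]
  exact Real.exp_le_exp.2 (mul_le_mul_of_nonneg_left hw hl)

lemma integrable_exp_Zd_mul (h : BousquetHyp m P Z Zd Y b σsq) {l : ℝ} (hl : 0 ≤ l) (i : ι)
    {g : Ω → ℝ} (hg : Integrable g P) : Integrable (fun w => Real.exp (l * Zd i w) * g w) P := by
  obtain ⟨C, hC⟩ := h.ae_norm_exp_Zd_le hl i
  exact hg.bdd_mul (c := C)
    ((h.stronglyMeasurable_exp_Zd l i).mono (iSup_mem_le h.le _)).aestronglyMeasurable hC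

lemma integrable_exp_Z_mul (h : BousquetHyp m P Z Zd Y b σsq) {l : ℝ} (hl : 0 ≤ l)
    {g : Ω → ℝ} (hg : Integrable g P) : Integrable (fun w => Real.exp (l * Z w) * g w) P := by
  obtain ⟨C, hC⟩ := h.ae_norm_exp_Z_le hl
  exact hg.bdd_mul (c := C) (h.integrable_exp hl).aestronglyMeasurable hC

lemma integral_exp_Zd_mul_Y_nonneg (h : BousquetHyp m P Z Zd Y b σsq) {l : ℝ} (hl : 0 ≤ l)
    (i : ι) : 0 ≤ ∫ w, Real.exp (l * Zd i w) * Y i w ∂P := by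
  rw [integral_mul_condExp_eq (iSup_mem_le h.le ({i}ᶜ : Set ι)) (h.stronglyMeasurable_exp_Zd l i)
    (h.integrable_exp_Zd_mul hl i (h.integrable_Y i)) (h.integrable_Y i)]
  refine integral_nonneg_of_ae ?_
  filter_upwards [h.condExp_Y_nonneg i] with w hw using mul_nonneg (Real.exp_pos _).le hw

/-- The tangent line gives `e^{lZ} ≥ e^{l Zd}(1 + l Y)`; conditioning leaves the factor `1 + l
E_i[Y] ≥ 1`. -/
lemma exp_Zd_le_condExp (h : BousquetHyp m P Z Zd Y b σsq) {l : ℝ} (hl : 0 ≤ l) (i : ι) :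
    ∀ᵐ w ∂P, Real.exp (l * Zd i w) ≤
      (P[fun w' => Real.exp (l * Z w') | ⨆ j ∈ ({i}ᶜ : Set ι), m j]) w := by
  have hgi : Integrable (fun w => 1 + l * Y i w) P :=
    (integrable_const 1).add ((h.integrable_Y i).const_mul l)
  have hmono := condExp_mono (m := ⨆ j ∈ ({i}ᶜ : Set ι), m j)
    (h.integrable_exp_Zd_mul hl i hgi) (h.integrable_exp hl) (by
      filter_upwards [h.Y_le_sub i] with w hw
      calc Real.exp (l * Zd i w) * (1 + l * Y i w)
          ≤ Real.exp (l * Zd i w) * Real.exp (l * (Z w - Zd i w)) := by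
            refine mul_le_mul_of_nonneg_left ?_ (Real.exp_pos _).le
            have := Real.add_one_le_exp (l * (Z w - Zd i w))
            have := mul_le_mul_of_nonneg_left hw hl
            linarith
        _ = Real.exp (l * Z w) := by rw [← Real.exp_add]; ring_nf)
  have hpull := condExp_mul_of_stronglyMeasurable_left (μ := P) (h.stronglyMeasurable_exp_Zd l i)
    (h.integrable_exp_Zd_mul hl i hgi) hgi
  have hadd := condExp_add (μ := P) (integrable_const (1 : ℝ)) ((h.integrable_Y i).const_mul l)
    (⨆ j ∈ ({i}ᶜ : Set ι), m j)
  have hsmul := condExp_smul (μ := P) l (Y i) (⨆ j ∈ ({i}ᶜ : Set ι), m j)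
  filter_upwards [hmono, hpull, hadd, hsmul, h.condExp_Y_nonneg i] with w e1 e2 e3 e4 e5
  refine le_trans ?_ e1
  refine le_trans ?_ e2.ge
  rw [Pi.mul_apply]
  refine le_mul_of_one_le_right (Real.exp_pos _).le ?_
  refine le_trans ?_ e3.ge
  rw [Pi.add_apply, condExp_const (iSup_mem_le h.le _)]
  have e6 : (P[fun w => l * Y i w | ⨆ j ∈ ({i}ᶜ : Set ι), m j]) w
      = l * (P[Y i | ⨆ j ∈ ({i}ᶜ : Set ι), m j]) w := e4
  rw [e6]
  linarith [mul_nonneg hl e5]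

/-- The variance bound holds only for the sum over `i`, so the weights `e^{l Zd i}` must first be
replaced by a common one. Conditioning turns `Y_i²` into `E_i[Y_i²]`, and `exp_Zd_le_condExp` then
allows the weight `e^{lZ}`. -/
lemma sum_integral_exp_Zd_mul_sq_le (h : BousquetHyp m P Z Zd Y b σsq) {l : ℝ} (hl : 0 ≤ l) :
    ∑ i, ∫ w, Real.exp (l * Zd i w) * Y i w ^ 2 ∂P ≤ σsq * ∫ w, Real.exp (l * Z w) ∂P := by
  set W : Ω → ℝ := fun w => Real.exp (l * Z w) with hW
  set F : ι → MeasurableSpace Ω := fun i => ⨆ j ∈ ({i}ᶜ : Set ι), m j with hF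
  have hFle : ∀ i, F i ≤ mΩ := fun i => iSup_mem_le h.le _
  have hYi : ∀ i, Integrable (fun w => Y i w ^ 2) P := fun i => (h.memLp_Y i).integrable_sq
  have hWQ : ∀ i, Integrable (fun w => W w * (P[fun w' => Y i w' ^ 2 | F i]) w) P := fun i =>
    h.integrable_exp_Z_mul hl integrable_condExp
  have hterm : ∀ i, ∫ w, Real.exp (l * Zd i w) * Y i w ^ 2 ∂P ≤
      ∫ w, W w * (P[fun w' => Y i w' ^ 2 | F i]) w ∂P := fun i => by
    have hpull := condExp_mul_of_stronglyMeasurable_right (μ := P) (m := F i) (f := W)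
      (stronglyMeasurable_condExp (μ := P) (f := fun w' => Y i w' ^ 2)) (hWQ i)
      (h.integrable_exp hl)
    rw [integral_mul_condExp_eq (hFle i) (h.stronglyMeasurable_exp_Zd l i)
      (h.integrable_exp_Zd_mul hl i (hYi i)) (hYi i),
      ← integral_condExp (hFle i) (f := fun w => W w * (P[fun w' => Y i w' ^ 2 | F i]) w)]
    refine integral_mono_ae (h.integrable_exp_Zd_mul hl i integrable_condExp)
      integrable_condExp ?_
    filter_upwards [hpull, h.exp_Zd_le_condExp hl i,
      condExp_sq_nonneg (P := P) (F i) (Y i)] with w e1 e2 e3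
    exact (mul_le_mul_of_nonneg_right e2 e3).trans e1.ge
  refine (Finset.sum_le_sum fun i _ => hterm i).trans ?_
  rw [← integral_finsetSum _ fun i _ => hWQ i, ← integral_const_mul]
  refine integral_mono_ae (integrable_finsetSum _ fun i _ => hWQ i)
    ((h.integrable_exp hl).const_mul σsq) ?_
  filter_upwards [h.sum_condExp_sq_le] with w hw
  rw [← Finset.mul_sum, mul_comm]
  exact mul_le_mul_of_nonneg_right hw (Real.exp_pos _).le

/-- The entropy bound for `e^{lZ}`. -/
lemma entropy_le (h : BousquetHyp m P Z Zd Y b σsq) (hb : 0 ≤ b) {l : ℝ} (hl : 0 ≤ l) :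
    (Real.exp l - 1 + 1 / (1 + b)) * (l * ∫ w, Z w * Real.exp (l * Z w) ∂P
      - mgf Z P l * Real.log (mgf Z P l))
      ≤ entTerm l 1 * (∫ w, Z w * Real.exp (l * Z w) ∂P + 1 / (1 + b) * σsq * mgf Z P l) := by
  obtain ⟨B, hB, hBd⟩ := h.exists_ae_le
  set α := 1 / (1 + b) with hα
  have hα0 : 0 < α := by positivity
  set κ := Real.exp l - 1 + α with hκ
  have hκ0 : 0 ≤ κ := by linarith [Real.one_le_exp hl]
  have hent := entropy_exp_le (P := P) (B := l * B) (U := fun w => l * Z w)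
    (V := fun i w => l * Zd i w) h.le h.indep (h.measurable_Z.const_mul l)
    (h.integrable_Z.const_mul l)
    (by filter_upwards [hB] with w hw using mul_le_mul_of_nonneg_left hw hl)
    (fun i => (h.measurable_Zd i).const_mul l) (fun i => (h.integrable_Zd i).const_mul l)
    (fun i => by filter_upwards [hBd i] with w hw using mul_le_mul_of_nonneg_left hw hl)
  have hU : ∫ w, Real.exp (l * Z w) * (l * Z w) ∂P = l * ∫ w, Z w * Real.exp (l * Z w) ∂P := by
    rw [← integral_const_mul]
    exact integral_congr_ae (Filter.Eventually.of_forall fun w => by simp only; ring)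
  rw [hU] at hent
  have hVi : ∀ i, Integrable (fun w => Real.exp (l * Z w) * (Z w - Zd i w)) P := fun i =>
    h.integrable_exp_Z_mul hl (h.integrable_Z.sub (h.integrable_Zd i))
  have hYi : ∀ i, Integrable (fun w => Real.exp (l * Zd i w) * Y i w) P := fun i =>
    h.integrable_exp_Zd_mul hl i (h.integrable_Y i)
  have hYi2 : ∀ i, Integrable (fun w => Real.exp (l * Zd i w) * Y i w ^ 2) P := fun i =>
    h.integrable_exp_Zd_mul hl i (h.memLp_Y i).integrable_sq
  have hterm : ∀ i, κ * ∫ w, (Real.exp (l * Z w) * (l * Z w - l * Zd i w) - Real.exp (l * Z w)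
      + Real.exp (l * Zd i w)) ∂P ≤ entTerm l 1 * (∫ w, Real.exp (l * Z w) * (Z w - Zd i w) ∂P
        + α * ∫ w, Real.exp (l * Zd i w) * Y i w ^ 2 ∂P) := fun i => by
    have hexpd : Integrable (fun w => Real.exp (l * Zd i w)) P := by
      simpa using h.integrable_exp_Zd_mul hl i (integrable_const (1 : ℝ))
    have hint : Integrable (fun w => Real.exp (l * Z w) * (l * Z w - l * Zd i w)
        - Real.exp (l * Z w) + Real.exp (l * Zd i w)) P :=
      ((h.integrable_exp_Z_mul hl ((h.integrable_Z.const_mul l).sub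
        ((h.integrable_Zd i).const_mul l))).sub (h.integrable_exp hl)).add hexpd
    have hVY : Integrable (fun w => Real.exp (l * Z w) * (Z w - Zd i w)
        - Real.exp (l * Zd i w) * Y i w) P := (hVi i).sub (hYi i)
    have hle : ∫ w, κ * (Real.exp (l * Z w) * (l * Z w - l * Zd i w) - Real.exp (l * Z w)
      + Real.exp (l * Zd i w)) ∂P ≤ ∫ w, entTerm l 1 * (Real.exp (l * Z w) * (Z w - Zd i w)
        - Real.exp (l * Zd i w) * Y i w + α * (Real.exp (l * Zd i w) * Y i w ^ 2)) ∂P := by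
      refine integral_mono_ae (hint.const_mul κ)
        ((hVY.add ((hYi2 i).const_mul α)).const_mul (entTerm l 1)) ?_
      -- Multiplied by `e^{l Zd i}`, `entTerm l (Z - Zd i)` is exactly the integrand of the
      -- logarithmic Sobolev inequality.
      filter_upwards [h.Y_le_sub i, h.sub_le_one i, h.Y_le i] with w h1 h2 h3
      have key := mul_le_mul_of_nonneg_left (entTerm_le hl hb h2 h1 h3)
        (Real.exp_pos (l * Zd i w)).le
      have hZ : Real.exp (l * Z w) = Real.exp (l * Zd i w) * Real.exp (l * (Z w - Zd i w)) := by
        rw [← Real.exp_add]; ring_nf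
      simp only [hZ]
      rw [entTerm] at key
      linarith
    rw [integral_const_mul, integral_const_mul, integral_add hVY ((hYi2 i).const_mul α),
      integral_sub (hVi i) (hYi i), integral_const_mul] at hle
    refine hle.trans (mul_le_mul_of_nonneg_left ?_ (entTerm_nonneg l 1))
    linarith [h.integral_exp_Zd_mul_Y_nonneg hl i]
  have hsumV : ∑ i, ∫ w, Real.exp (l * Z w) * (Z w - Zd i w) ∂P
      ≤ ∫ w, Z w * Real.exp (l * Z w) ∂P := by
    rw [← integral_finsetSum _ fun i _ => hVi i]
    refine integral_mono_ae (integrable_finsetSum _ fun i _ => hVi i) ?_ ?_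
    · simpa only [mul_comm] using h.integrable_exp_Z_mul hl h.integrable_Z
    · filter_upwards [h.sum_le] with w hw
      rw [← Finset.mul_sum, mul_comm (Z w)]
      exact mul_le_mul_of_nonneg_left hw (Real.exp_pos _).le
  refine (mul_le_mul_of_nonneg_left hent hκ0).trans ?_
  rw [Finset.mul_sum]
  refine (Finset.sum_le_sum fun i _ => hterm i).trans ?_
  rw [← Finset.mul_sum, Finset.sum_add_distrib, ← Finset.mul_sum]
  refine mul_le_mul_of_nonneg_left ?_ (entTerm_nonneg l 1)
  have := mul_le_mul_of_nonneg_left (h.sum_integral_exp_Zd_mul_sq_le hl) hα0.le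
  rw [mgf]
  linarith

lemma mem_interior_integrableExpSet (h : BousquetHyp m P Z Zd Y b σsq) {l : ℝ} (hl : 0 < l) :
    l ∈ interior (integrableExpSet Z P) :=
  mem_interior.2 ⟨Set.Ioi 0, fun _ hx => h.integrable_exp (Set.mem_Ioi.1 hx).le, isOpen_Ioi, hl⟩

/-- The initial condition for the differential inequality. `Z` is bounded only from above, so the
expansion at `0` is one-sided: `δ` ensures `l Z ≤ 1`, where `e^u ≤ 1 + u + u²`. -/
lemma exists_log_mgf_le (h : BousquetHyp m P Z Zd Y b σsq) : ∃ C δ : ℝ, 0 < δ ∧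
    ∀ l, 0 < l → l < δ → Real.log (mgf Z P l) ≤ l * ∫ w, Z w ∂P + C * l ^ 2 := by
  obtain ⟨B, hB, -⟩ := h.exists_ae_le
  refine ⟨∫ w, Z w ^ 2 ∂P, 1 / (|B| + 1), by positivity, fun l hl hlδ => ?_⟩
  have hlB : l * B ≤ 1 := by
    have h1 : l * (|B| + 1) < 1 := (lt_div_iff₀ (by positivity)).1 hlδ
    have h2 := mul_le_mul_of_nonneg_left (le_abs_self B) hl.le
    linarith
  have hlin : Integrable (fun w => 1 + l * Z w) P :=
    (integrable_const 1).add (h.integrable_Z.const_mul l)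
  have hsq : Integrable (fun w => l ^ 2 * Z w ^ 2) P := h.memLp_Z.integrable_sq.const_mul _
  have hle : mgf Z P l ≤ ∫ w, (1 + l * Z w + l ^ 2 * Z w ^ 2) ∂P := by
    refine integral_mono_ae (h.integrable_exp hl.le) (hlin.add hsq) ?_
    filter_upwards [hB] with w hw
    have := exp_le_one_add_add_sq ((mul_le_mul_of_nonneg_left hw hl.le).trans hlB)
    rwa [mul_pow] at this
  rw [integral_add hlin hsq, integral_add (integrable_const 1) (h.integrable_Z.const_mul l),
    integral_const_mul, integral_const_mul] at hle
  simp only [integral_const, probReal_univ, smul_eq_mul, mul_one] at hle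
  have := Real.log_le_sub_one_of_pos (mgf_pos (h.integrable_exp hl.le))
  linarith

lemma b_nonneg (h : BousquetHyp m P Z Zd Y b σsq) (i : ι) : 0 ≤ b := by
  have h1 : ∫ w, Y i w ∂P ≤ ∫ _, b ∂P :=
    integral_mono_ae (h.integrable_Y i) (integrable_const b) (h.Y_le i)
  rw [← integral_condExp (iSup_mem_le h.le ({i}ᶜ : Set ι)), integral_const, probReal_univ,
    one_smul] at h1
  exact (integral_nonneg_of_ae (h.condExp_Y_nonneg i)).trans h1

/-- **Bousquet's inequality** for the moment generating function of `Z`. -/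
theorem mgf_le (h : BousquetHyp m P Z Zd Y b σsq) (hb : 0 ≤ b) {l : ℝ} (hl : 0 ≤ l) :
    mgf Z P l ≤ Real.exp (l * ∫ w, Z w ∂P +
      ((1 + b) * ∫ w, Z w ∂P + σsq) * (Real.exp l - l - 1)) := by
  rcases hl.eq_or_lt with rfl | hl
  · simp
  obtain ⟨C, δ, hδ, hC⟩ := h.exists_log_mgf_le
  have hpos : ∀ x : ℝ, 0 < x → 0 < mgf Z P x := fun x hx => mgf_pos (h.integrable_exp hx.le)
  rw [← Real.log_le_iff_le_exp (hpos l hl)]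
  refine le_of_entropy_differential_inequality (M := fun x => Real.log (mgf Z P x))
    (M' := fun x => (∫ w, Z w * Real.exp (x * Z w) ∂P) / mgf Z P x) (α := 1 / (1 + b)) (s := σsq)
    (C := C) (by positivity) ?_ hδ (fun x hx => ?_) (fun x hx => ?_) ?_ hC hl
  · have := h.integral_Z_nonneg
    have := h.sigmaSq_nonneg
    positivity
  · exact (hasDerivAt_mgf (h.mem_interior_integrableExpSet hx)).log (hpos x hx).ne'
  -- The differential inequality for `log mgf` is the entropy bound divided by the moment generating
  -- function.
  · have := h.entropy_le hb hx.le
    have hG := hpos x hx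
    generalize ∫ w, Z w * Real.exp (x * Z w) ∂P = H at this ⊢
    refine le_of_mul_le_mul_right ?_ hG
    calc _ = _ := ?_
      _ ≤ _ := this
      _ = _ := ?_
    · field_simp
    · field_simp
  · field_simp

end BousquetHyp

/-! ### Tail bounds -/

section Tail

variable {Ω : Type*} {mΩ : MeasurableSpace Ω} {P : Measure Ω}

/-- Combination of moment generating function bounds of arbitrarily dependent summands. -/
lemma mgf_sum_le {A : Type*} [Fintype A] {Za : A → Ω → ℝ} {E v : A → ℝ} {l g N : ℝ}
    (hN : N = Fintype.card A) (hN0 : 0 < N)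
    (hint : ∀ a, Integrable (fun w => Real.exp (l * Za a w)) P)
    (hmgf : ∀ a, mgf (Za a) P l ≤ Real.exp (l * E a + v a * g)) {Z : Ω → ℝ}
    (hZ : ∀ w, Z w = ∑ a, Za a w) (hZm : AEMeasurable Z P) :
    Integrable (fun w => Real.exp (l / N * Z w)) P ∧
      mgf Z P (l / N) ≤ Real.exp (l / N * ∑ a, E a + (∑ a, v a) / N * g) := by
  set q : ℝ := l / N * ∑ a, E a + (∑ a, v a) / N * g with hq
  set u : A → ℝ := fun a => l * E a + v a * g with hu
  have hle : ∀ w, Real.exp (l / N * Z w) ≤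
      Real.exp q * ∑ a, N⁻¹ * (Real.exp (-u a) * Real.exp (l * Za a w)) := fun w => by
    -- Jensen's inequality is applied to the exponents `l Z_a - u_a`: each of their exponentials has
    -- mean at most `1`, so the equally weighted average does too, whatever the dependence.
    have hconv := convexOn_exp.map_sum_le (t := Finset.univ) (w := fun _ : A => N⁻¹)
      (p := fun a => l * Za a w - u a) (fun _ _ => (inv_pos.2 hN0).le)
      (by rw [Finset.sum_const, Finset.card_univ, nsmul_eq_mul, ← hN, mul_inv_cancel₀ hN0.ne'])
      (fun _ _ => Set.mem_univ _)
    simp only [smul_eq_mul] at hconv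
    have hexp : l / N * Z w = q + ∑ a, N⁻¹ * (l * Za a w - u a) := by
      rw [← Finset.mul_sum, Finset.sum_sub_distrib, ← Finset.mul_sum, ← hZ w, hu,
        Finset.sum_add_distrib, ← Finset.mul_sum, ← Finset.sum_mul, hq]
      field_simp
      ring
    rw [hexp, Real.exp_add]
    refine mul_le_mul_of_nonneg_left (hconv.trans_eq ?_) (Real.exp_pos _).le
    refine Finset.sum_congr rfl fun a _ => ?_
    rw [← Real.exp_add, sub_eq_neg_add]
  have hi : Integrable
      (fun w => Real.exp q * ∑ a, N⁻¹ * (Real.exp (-u a) * Real.exp (l * Za a w))) P :=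
    (integrable_finsetSum _ fun a _ => ((hint a).const_mul _).const_mul _).const_mul _
  have hiZ : Integrable (fun w => Real.exp (l / N * Z w)) P :=
    hi.mono' (Real.measurable_exp.comp_aemeasurable (hZm.const_mul _)).aestronglyMeasurable
      (Filter.Eventually.of_forall fun w => by
        rw [Real.norm_eq_abs, Real.abs_exp]; exact hle w)
  refine ⟨hiZ, ?_⟩
  calc mgf Z P (l / N)
      ≤ ∫ w, Real.exp q * ∑ a, N⁻¹ * (Real.exp (-u a) * Real.exp (l * Za a w)) ∂P :=
        integral_mono hiZ hi hle
    _ = Real.exp q * ∑ a, N⁻¹ * (Real.exp (-u a) * mgf (Za a) P l) := by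
        rw [integral_const_mul, integral_finsetSum _ fun a _ =>
          ((hint a).const_mul _).const_mul _]
        simp only [integral_const_mul, mgf]
    _ ≤ Real.exp q * ∑ _a : A, N⁻¹ * 1 := by
        refine mul_le_mul_of_nonneg_left (Finset.sum_le_sum fun a _ => ?_) (Real.exp_pos _).le
        refine mul_le_mul_of_nonneg_left ?_ (inv_pos.2 hN0).le
        calc Real.exp (-u a) * mgf (Za a) P l ≤ Real.exp (-u a) * Real.exp (u a) :=
              mul_le_mul_of_nonneg_left (hmgf a) (Real.exp_pos _).le
          _ = 1 := by rw [← Real.exp_add]; simp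
    _ = Real.exp q := by
        rw [Finset.sum_const, Finset.card_univ, nsmul_eq_mul, ← hN, mul_one,
          mul_inv_cancel₀ hN0.ne', mul_one]

variable [IsProbabilityMeasure P] {Z : Ω → ℝ} {E v N : ℝ}

lemma measure_ge_le_of_mgf_le
    (hint : ∀ l, 0 ≤ l → Integrable (fun w => Real.exp (l / N * Z w)) P)
    (hmgf : ∀ l, 0 ≤ l → mgf Z P (l / N) ≤ Real.exp (l / N * E + v / N * (Real.exp l - l - 1)))
    (hN : 1 ≤ N) (t : ℝ) {l : ℝ} (hl : 0 ≤ l) :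
    P.real {w | Z w ≥ E + t} ≤ Real.exp (-(l / N * t) + v / N * (Real.exp l - l - 1)) := by
  have h := measure_ge_le_exp_mul_mgf (E + t) (div_nonneg hl (by linarith)) (hint l hl)
  refine h.trans ((mul_le_mul_of_nonneg_left (hmgf l hl) (Real.exp_pos _).le).trans_eq ?_)
  rw [← Real.exp_add]
  ring_nf

/-- The Bennett tail bound. -/
lemma bennett_of_mgf_le
    (hint : ∀ l, 0 ≤ l → Integrable (fun w => Real.exp (l / N * Z w)) P)
    (hmgf : ∀ l, 0 ≤ l → mgf Z P (l / N) ≤ Real.exp (l / N * E + v / N * (Real.exp l - l - 1)))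
    (hN : 1 ≤ N) (hv : 0 ≤ v) {t : ℝ} (ht : 0 < t) :
    P.real {w | Z w ≥ E + t} ≤ Real.exp (-(v * bennettPhi (t / (v * N)))) := by
  -- For `v = 0` the right side is `exp 0 = 1`.
  rcases hv.eq_or_lt with rfl | hv
  · simp
  have hN0 : 0 < N := by linarith
  set x := t / (v * N) with hx
  have hx0 : 0 < x := by positivity
  have htx : t = v * N * x := by rw [hx]; field_simp
  -- The choice `l = log(1 + x)` with `x = t/(vN)` is not optimal (that would be `log(1 + t/v)`),
  -- but it yields the stated form directly through `N⁻¹ (x - log(1 + x)) ≤ x - log(1 + x)`.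
  refine (measure_ge_le_of_mgf_le hint hmgf hN t
    (Real.log_nonneg (by linarith : 1 ≤ 1 + x))).trans (Real.exp_le_exp.2 ?_)
  rw [Real.exp_log (by linarith)]
  have hlog : Real.log (1 + x) ≤ x := by
    linarith [Real.log_le_sub_one_of_pos (by linarith : 0 < 1 + x)]
  have e : -(Real.log (1 + x) / N * t) + v / N * (1 + x - Real.log (1 + x) - 1)
      = v * (-(x * Real.log (1 + x)) + N⁻¹ * (x - Real.log (1 + x))) := by
    rw [htx]; field_simp; ring
  rw [e, show -(v * bennettPhi x) = v * -bennettPhi x by ring]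
  refine mul_le_mul_of_nonneg_left ?_ hv.le
  have := mul_le_mul_of_nonneg_right (inv_le_one_of_one_le₀ hN) (sub_nonneg.2 hlog)
  unfold bennettPhi
  linarith

/-- The Bernstein tail bound. -/
lemma bernstein_of_mgf_le
    (hint : ∀ l, 0 ≤ l → Integrable (fun w => Real.exp (l / N * Z w)) P)
    (hmgf : ∀ l, 0 ≤ l → mgf Z P (l / N) ≤ Real.exp (l / N * E + v / N * (Real.exp l - l - 1)))
    (hN : 1 ≤ N) (hv : 0 ≤ v) {t : ℝ} (ht : 0 < t) :
    P.real {w | Z w ≥ E + N * √(2 * v * t) + 2 * N * t / 3} ≤ Real.exp (-t) := by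
  have hN0 : 0 < N := by linarith
  rcases hv.eq_or_lt with rfl | hv
  -- For `v = 0` the Bennett bound is void; `l = 3/2` makes the exponent exactly `-t`.
  · have h := measure_ge_le_of_mgf_le hint hmgf hN (2 * N * t / 3) (l := 3 / 2) (by norm_num)
    have e : -((3 / 2 : ℝ) / N * (2 * N * t / 3)) = -t := by field_simp
    rw [zero_div, zero_mul, add_zero, e] at h
    simpa using h
  set r := √(2 * v * t) with hr
  have hr0 : 0 ≤ r := Real.sqrt_nonneg _
  have hr2 : r ^ 2 = 2 * v * t := Real.sq_sqrt (by positivity)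
  have h := bennett_of_mgf_le hint hmgf hN hv.le (t := N * r + 2 * N * t / 3) (by positivity)
  rw [← add_assoc] at h
  refine h.trans (Real.exp_le_exp.2 (neg_le_neg ?_))
  set s := r + 2 * t / 3 with hs
  have hs0 : 0 < s := by positivity
  have e : (N * r + 2 * N * t / 3) / (v * N) = s / v := by rw [hs]; field_simp
  rw [e]
  have hphi := sq_div_le_bennettPhi (div_nonneg hs0.le hv.le)
  refine le_trans ?_ (mul_le_mul_of_nonneg_left hphi hv.le)
  have e2 : v * ((s / v) ^ 2 / (2 + 2 * (s / v) / 3)) = s ^ 2 / (2 * v + 2 * s / 3) := by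
    field_simp
  rw [e2, le_div_iff₀ (by positivity)]
  -- After clearing the denominator, with `r² = 2vt`, the two sides differ by `2rt/3`.
  have : 0 ≤ r * t := mul_nonneg hr0 ht.le
  rw [hs]
  nlinarith

end Tail

/-! ### Multi-fractionally sub-additive functions -/

/-- The full vertex set is a single independent set of weight `1`, and the weights at any one vertex
already sum to `1`. -/
lemma fracChromaticNumber_bot {V : Type*} [DecidableEq V] [Fintype V] [Nonempty V] :
    fracChromaticNumber (⊥ : SimpleGraph V) = 1 := by
  refine IsLeast.csInf_eq ⟨⟨1, fun _ => Finset.univ, fun _ => 1, ⟨?_, ?_, ?_, ?_⟩, ?_⟩, ?_⟩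
  · simp
  · simp
  · simp
  · intro j u _ v _ _
    simp
  · simp
  · rintro s ⟨J, I, ω, hc, rfl⟩
    obtain ⟨u⟩ := ‹Nonempty V›
    rw [← hc.sum_weight u]
    exact Finset.sum_le_sum_of_subset_of_nonneg (Finset.filter_subset _ _)
      fun j _ _ => (hc.weight_pos j).le

lemma comap_pi_eq_iSup {Ω ι 𝒳 : Type*} [MeasurableSpace 𝒳] (x : ι → Ω → 𝒳) :
    MeasurableSpace.comap (fun w i => x i w) inferInstance
      = ⨆ i, MeasurableSpace.comap (x i) inferInstance := by
  change MeasurableSpace.comap _ MeasurableSpace.pi = _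
  rw [MeasurableSpace.pi, MeasurableSpace.comap_iSup]
  simp only [MeasurableSpace.comap_comp]
  rfl

lemma comap_deleteAt_eq_iSup {Ω ι 𝒳 : Type*} [MeasurableSpace 𝒳] (x : ι → Ω → 𝒳) (i : ι) :
    MeasurableSpace.comap (fun w => deleteAt i (fun i' => x i' w)) inferInstance
      = ⨆ j ∈ ({i}ᶜ : Set ι), MeasurableSpace.comap (x j) inferInstance :=
  (comap_pi_eq_iSup fun i' : {i' : ι // i' ≠ i} => x i').trans iSup_subtype

namespace MultiFracDecomp

variable {Ω 𝒳 : Type*} [MeasurableSpace Ω] [MeasurableSpace 𝒳] {K : ℕ} {m : Fin K → ℕ}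
  {G : ∀ k, SimpleGraph (Fin (m k))} {f : (∀ k, Fin (m k) → 𝒳) → ℝ} {D : MultiFracDecomp G f}
  {X : ∀ k, Fin (m k) → Ω → 𝒳} {P : Measure Ω} {Y : ∀ k (j : Fin (D.J k)), D.I k j → Ω → ℝ}
  {b σsq : ∀ k, Fin (D.J k) → ℝ}

/-- Every `I_kj` is an independent set of `G_k`, so the dependency graph makes its variables
mutually independent. -/
lemma BennettAssumption.bousquetHyp (hA : D.BennettAssumption X P Y b σsq)
    (hX : ∀ k i, Measurable (X k i)) (hG : ∀ k, IsDependencyGraph (G k) (X k) P)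
    (k : Fin K) (j : Fin (D.J k)) :
    BousquetHyp (fun i : D.I k j => MeasurableSpace.comap (X k i) inferInstance) P
      (D.zPart X k j) (D.zDel X k j) (Y k j) (b k j) (σsq k j) := by
  have hdel : ∀ i, D.sigmaDel X k j i = ⨆ i' ∈ ({i}ᶜ : Set (D.I k j)),
      MeasurableSpace.comap (X k i') inferInstance := fun i =>
    comap_deleteAt_eq_iSup (fun i' : D.I k j => X k i') i
  refine
    { le := fun i => (hX k i).comap_le
      indep := (hG k (D.I k j) ((D.cover k).indep j)).iIndep
      measurable_Z := ?_
      integrable_Z := hA.integrable_zPart k j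
      measurable_Zd := fun i => ?_
      sum_le := Filter.Eventually.of_forall fun w => D.subAdditive k j _
      memLp_Y := hA.memLp_Y k j
      Y_le_sub := hA.Y_le_sub k j
      sub_le_one := hA.sub_le_one k j
      condExp_Y_nonneg := fun i => ?_
      Y_le := hA.Y_le k j
      sum_condExp_sq_le := ?_ }
  · have hpart : D.sigmaPart X k j = ⨆ i ∈ (Set.univ : Set (D.I k j)),
        MeasurableSpace.comap (X k i) inferInstance := by
      rw [iSup_univ]
      exact comap_pi_eq_iSup (fun i : D.I k j => X k i)
    rw [← hpart]
    exact (D.measurable_fPart k j).comp (comap_measurable _)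
  · rw [← hdel i]
    exact (D.measurable_fDel k j i).comp (comap_measurable _)
  · rw [← hdel i]
    exact hA.condExp_Y_nonneg k j i
  · simp only [← hdel]
    exact hA.sum_condExp_sq_le k j

end MultiFracDecomp

theorem mainTheorem9 {Ω 𝒳 : Type*} [MeasurableSpace Ω] [MeasurableSpace 𝒳]
    (P : Measure Ω) [IsProbabilityMeasure P]
    {K : ℕ} {m : Fin K → ℕ} (hm : ∃ k, 0 < m k)
    (X : ∀ k, Fin (m k) → Ω → 𝒳) (hX : ∀ k i, Measurable (X k i))
    (G : ∀ k, SimpleGraph (Fin (m k))) (hG : ∀ k, IsDependencyGraph (G k) (X k) P)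
    (f : (∀ k, Fin (m k) → 𝒳) → ℝ) (D : MultiFracDecomp G f)
    (hopt : ∀ k, ∑ j, D.ω k j = fracChromaticNumber (G k))
    (Y : ∀ k (j : Fin (D.J k)), D.I k j → Ω → ℝ) (bb σsq : ∀ k, Fin (D.J k) → ℝ)
    (hA : D.BennettAssumption X P Y bb σsq)
    (b : ℝ) (hb : ∀ k j, bb k j = b) (hω : ∀ k j, D.ω k j = 1)
    (Z : Ω → ℝ) (hZ : ∀ w, Z w = f (fun k i => X k i w))
    (v : ℝ) (hv : v = (1 + b) * (∫ w, Z w ∂P) + ∑ k, ∑ j, D.ω k j * σsq k j)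
    (c : ℝ) (hc : c = ∑ k, fracChromaticNumber (G k)) :
    (∀ t : ℝ, 0 < t →
      P.real {w | Z w ≥ (∫ w', Z w' ∂P) + t} ≤ Real.exp (-(v * bennettPhi (t / (v * c))))) ∧
    (∀ t : ℝ, 0 < t →
      P.real {w | Z w ≥ (∫ w', Z w' ∂P) + c * √(2 * v * t) + 2 * c * t / 3} ≤ Real.exp (-t)) ∧
    (K = 1 →
      ((∀ k, G k = ⊥) → ∀ k, fracChromaticNumber (G k) = 1) ∧
      ((∀ k, fracChromaticNumber (G k) = 1) → ∀ t : ℝ, 0 < t →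
        P.real {w | Z w ≥ (∫ w', Z w' ∂P) + t} ≤ Real.exp (-(v * bennettPhi (t / v))) ∧
        P.real {w | Z w ≥ (∫ w', Z w' ∂P) + √(2 * v * t) + 2 * t / 3} ≤ Real.exp (-t))) := by
  have hH := hA.bousquetHyp hX hG
  have hint : ∀ a : Σ k, Fin (D.J k), Integrable (D.zPart X a.1 a.2) P := fun a =>
    hA.integrable_zPart a.1 a.2
  have hZsum : ∀ w, Z w = ∑ a : Σ k, Fin (D.J k), D.zPart X a.1 a.2 w := fun w => by
    rw [hZ, D.eq_sum_block, Fintype.sum_sigma]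
    refine Finset.sum_congr rfl fun k _ => ?_
    rw [D.block_eq_sum]
    exact Finset.sum_congr rfl fun j _ => by rw [hω, one_mul]; rfl
  have hZint : Integrable Z P := by
    rw [funext hZsum]
    exact integrable_finsetSum _ fun a _ => hint a
  have hEsum : ∫ w, Z w ∂P = ∑ a : Σ k, Fin (D.J k), ∫ w, D.zPart X a.1 a.2 w ∂P := by
    rw [funext hZsum]
    exact integral_finsetSum _ fun a _ => hint a
  -- Here unit weights matter: the total weight of each cover is then its number of parts.
  have hcN : c = Fintype.card (Σ k, Fin (D.J k)) := by
    rw [hc, Fintype.card_sigma, Nat.cast_sum]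
    exact Finset.sum_congr rfl fun k _ => by rw [← hopt k]; simp [hω]
  obtain ⟨k₀, hk₀⟩ := hm
  obtain ⟨j₀, hj₀⟩ : ∃ j, (⟨0, hk₀⟩ : Fin (m k₀)) ∈ D.I k₀ j := by
    by_contra! hcon
    simpa [hcon] using (D.cover k₀).sum_weight ⟨0, hk₀⟩
  -- `b ≥ 0` needs some nonempty part; one exists because some block has a vertex, which must be
  -- covered.
  have hb0 : 0 ≤ b := hb k₀ j₀ ▸ (hH k₀ j₀).b_nonneg ⟨_, hj₀⟩
  have hc1 : 1 ≤ c := by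
    rw [hcN]
    exact_mod_cast (Fintype.card_pos_iff.2 ⟨⟨k₀, j₀⟩⟩ : 0 < Fintype.card (Σ k, Fin (D.J k)))
  have hvsum : v = ∑ a : Σ k, Fin (D.J k),
      ((1 + b) * ∫ w, D.zPart X a.1 a.2 w ∂P + σsq a.1 a.2) := by
    rw [hv, hEsum, Finset.sum_add_distrib, ← Finset.mul_sum,
      Fintype.sum_sigma (fun a : Σ k, Fin (D.J k) => σsq a.1 a.2)]
    simp only [hω, one_mul]
  have hv0 : 0 ≤ v := by
    rw [hvsum]
    refine Finset.sum_nonneg fun a _ => add_nonneg (mul_nonneg (by linarith) ?_) ?_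
    · exact (hH a.1 a.2).integral_Z_nonneg
    · exact (hH a.1 a.2).sigmaSq_nonneg
  have hmgf : ∀ l : ℝ, 0 ≤ l → Integrable (fun w => Real.exp (l / c * Z w)) P ∧
      mgf Z P (l / c) ≤ Real.exp (l / c * ∫ w, Z w ∂P + v / c * (Real.exp l - l - 1)) :=
    fun l hl => by
    rw [hvsum, hEsum]
    refine mgf_sum_le hcN (by linarith) (fun a => (hH a.1 a.2).integrable_exp hl) (fun a => ?_)
      hZsum hZint.aemeasurable
    have := (hH a.1 a.2).mgf_le (by rw [hb]; exact hb0) hl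
    rwa [hb] at this
  have bennett := fun t (ht : (0 : ℝ) < t) => bennett_of_mgf_le (fun l hl => (hmgf l hl).1)
    (fun l hl => (hmgf l hl).2) hc1 hv0 ht
  have bernstein := fun t (ht : (0 : ℝ) < t) => bernstein_of_mgf_le (fun l hl => (hmgf l hl).1)
    (fun l hl => (hmgf l hl).2) hc1 hv0 ht
  refine ⟨bennett, bernstein, ?_⟩
  rintro rfl
  refine ⟨fun hbot k => ?_, fun hone t ht => ?_⟩
  · have : Nonempty (Fin (m k)) := ⟨⟨0, Subsingleton.elim k₀ k ▸ hk₀⟩⟩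
    rw [hbot k]
    exact fracChromaticNumber_bot
  · have hc' : c = 1 := by rw [hc]; simp [hone]
    have h1 := bennett t ht
    have h2 := bernstein t ht
    rw [hc'] at h1 h2
    simp only [mul_one, one_mul] at h1 h2
    exact ⟨h1, h2⟩
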